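/- All graphs are finite and simple. A \emph{3-decomposition} of a graph $G$ is a triple $(T,C,M)$ of subgraphs of $G$ such that $T$ is a spanning tree of $G$, $C$ is 2-regular, $M$ is 1-regular (a possibly empty matching), and every edge of $G$ lies in exactly one of $T$, $C$, $M$. The 3-decomposition conjecture asserts that every connected cubic graph has a 3-decomposition. A \emph{minimal 3-connected counterexample} is a 3-connected cubic graph $G$ without a 3-decomposition such that every 3-connected cubic graph with fewer vertices than $G$ has a 3-decomposition. A subcubic graph $S$ is a \emph{reducible configuration} if no minimal 3-connected counterexample contains a (not necessarily induced) subgraph isomorphic to $S$. \textbf{Theorem.} Each of the following six graphs is a reducible configuration: \begin{enumerate} \item the triangle $K_3$; \item the complete bipartite graph $K_{2,3}$; \item the Petersen graph with one vertex removed; \item the claw-square: the graph on $8$ vertices consisting of a $4$-cycle $s_0s_1s_2s_3s_0$, a vertex $c$ adjacent to three further vertices $\ell_0,\ell_1,\ell_2$, and the edges $\ell_0s_0,\ \ell_1s_1,\ \ell_2s_2$; \item the twin-house: the graph on the vertices $u_1,\dots,u_6$ with edges $u_1u_2,\ u_1u_5,\ u_2u_6,\ u_5u_3,\ u_5u_4,\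 u_6u_3,\ u_6u_4$; \item the domino: the graph on the vertices $u_1,\dots,u_6$ with edges $u_1u_2,\ u_1u_5,\ u_2u_6,\ u_5u_6,\ u_5u_3,\ u_6u_4,\ u_3u_4$. \end{enumerate} -/

import Mathlib

universe u

namespace ThreeDec

open SimpleGraph

/-- Every vertex has exactly three neighbours. -/
def IsCubic {V : Type*} (G : SimpleGraph V) : Prop :=
  ∀ v : V, (G.neighborSet v).ncard = 3

/-- Every vertex has at most three neighbours (used for finite graphs only). -/
def IsSubcubic {V : Type*} [Finite V] (G : SimpleGraph V) : Prop :=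
  ∀ v : V, (G.neighborSet v).ncard ≤ 3

/-- `k`-connectedness of a finite graph: there are more than `k` vertices, and deleting fewer than
`k` vertices always leaves a connected graph. -/
def IsKConnected {V : Type*} [Finite V] (k : ℕ) (G : SimpleGraph V) : Prop :=
  k < Nat.card V ∧ ∀ X : Finset V, X.card < k → (G.induce {v | v ∉ X}).Connected

/-- `(T, C, M)` is a 3-decomposition of `G`: `T` is a spanning tree, `C` is a 2-regular subgraph,
`M` is a 1-regular subgraph (a possibly empty matching), and every edge of `G` lies in exactly one
of the three subgraphs. -/
structure IsThreeDecomposition {V : Type*} (G : SimpleGraph V) (T C M : G.Subgraph) : Prop where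
  spanning : T.IsSpanning
  tree : T.coe.IsTree
  two_regular : ∀ v ∈ C.verts, (C.neighborSet v).ncard = 2
  matching : M.IsMatching
  edges : ∀ e ∈ G.edgeSet,
    (e ∈ T.edgeSet ∧ e ∉ C.edgeSet ∧ e ∉ M.edgeSet) ∨
    (e ∉ T.edgeSet ∧ e ∈ C.edgeSet ∧ e ∉ M.edgeSet) ∨
    (e ∉ T.edgeSet ∧ e ∉ C.edgeSet ∧ e ∈ M.edgeSet)

/-- `G` has a 3-decomposition. -/
def HasThreeDecomposition {V : Type*} (G : SimpleGraph V) : Prop :=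
  ∃ T C M : G.Subgraph, IsThreeDecomposition G T C M

/-- `G` is a 3-connected counterexample to the 3-decomposition conjecture: a 3-connected cubic
graph without a 3-decomposition. -/
def IsThreeConnectedCounterexample {V : Type*} [Finite V] (G : SimpleGraph V) : Prop :=
  IsCubic G ∧ IsKConnected 3 G ∧ ¬ HasThreeDecomposition G

/-- `G` is a 3-connected counterexample with the minimum number of vertices. -/
def IsMinimalThreeConnectedCounterexample {V : Type u} [Finite V] (G : SimpleGraph V) : Prop :=
  IsThreeConnectedCounterexample G ∧
    ∀ (W : Type u) [Finite W] (G' : SimpleGraph W),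
      IsThreeConnectedCounterexample G' → Nat.card V ≤ Nat.card W

/-- A finite subcubic graph `S` is a reducible configuration if no minimal 3-connected
counterexample to the 3-decomposition conjecture contains a (not necessarily induced) subgraph
isomorphic to `S`. -/
def IsReducibleConfiguration {α : Type*} [Finite α] (S : SimpleGraph α) : Prop :=
  IsSubcubic S ∧
    ∀ (V : Type u) [Finite V] (G : SimpleGraph V),
      IsMinimalThreeConnectedCounterexample G → ¬ S.IsContained G

/-- The triangle `K₃`. -/
def triangle : SimpleGraph (Fin 3) := completeGraph (Fin 3)

/-- The complete bipartite graph `K_{2,3}`. -/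
def ktwothree : SimpleGraph (Fin 2 ⊕ Fin 3) := completeBipartiteGraph (Fin 2) (Fin 3)

/-- The Petersen graph: an outer 5-cycle on `0, …, 4`, an inner pentagram on `5, …, 9`, and the
spokes joining `i` to `i + 5`. -/
def petersen : SimpleGraph (Fin 10) :=
  fromEdgeSet {s(0, 1), s(1, 2), s(2, 3), s(3, 4), s(4, 0),
    s(5, 7), s(7, 9), s(9, 6), s(6, 8), s(8, 5),
    s(0, 5), s(1, 6), s(2, 7), s(3, 8), s(4, 9)}

/-- The Petersen graph with one vertex removed. As the Petersen graph is vertex-transitive, the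
choice of this vertex does not matter. -/
def petersenMinusVertex : SimpleGraph {v : Fin 10 // v ≠ 0} := petersen.induce {v | v ≠ 0}

/-- The claw-square: a square `0 1 2 3`, a claw with centre `7` and leaves `4, 5, 6`, and the three
edges joining the leaves of the claw to three distinct vertices `0, 1, 2` of the square. -/
def clawSquare : SimpleGraph (Fin 8) :=
  fromEdgeSet {s(0, 1), s(1, 2), s(2, 3), s(3, 0),
    s(7, 4), s(7, 5), s(7, 6),
    s(4, 0), s(5, 1), s(6, 2)}

/-- The twin-house: the 5-cycle `0 1 5 2 4` together with a twin `3` of the vertex `2`, that is,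
a further vertex `3` joined to the neighbours `4` and `5` of `2`. -/
def twinHouse : SimpleGraph (Fin 6) :=
  fromEdgeSet {s(0, 1), s(0, 4), s(1, 5), s(4, 2), s(4, 3), s(5, 2), s(5, 3)}

/-- The domino: two squares `0 1 5 4` and `4 5 3 2` sharing the edge `45`. -/
def domino : SimpleGraph (Fin 6) :=
  fromEdgeSet {s(0, 1), s(0, 4), s(1, 5), s(4, 5), s(4, 2), s(5, 3), s(2, 3)}

end ThreeDec

/-! In a cubic graph a 3-decomposition amounts to a balanced tree, that is, a spanning tree such
that every edge outside it joins two vertices of equal tree degree. The ends of an edge of the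
2-regular part have tree degree 1, those of a matching edge have tree degree 2, and conversely the
non-tree edges are sorted into the two parts by the degree of their ends.

Suppose that a minimal counterexample `G` contains a configuration `S`. Three or four vertices of
`S`, its ports, have degree two in `S` and send one further edge each. Replace `S` by a smaller
fragment `R`: a single vertex for three ports, an edge with two ports at each end for four. If the
result is a simple 3-connected graph, minimality gives it a balanced tree, which leaves a forest `F`
outside of `R`. To extend `F` into `S` it suffices to know which ports are joined by `F`, which port
edges lie in the tree, and the tree degrees at the ports of `R`. These are finitely many states, and
for each that can occur a table supplies a tree part of `S` that completes `F` to a balanced tree of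
`G` (`Fragment.IsOuterTree.hasBalancedTree`). The kernel checks the tables.

That the smaller graph is 3-connected is proved with edge cuts: a cubic graph is 3-connected if and
only if at least three edges leave every nonempty proper vertex set. Contraction to a vertex only
keeps cuts of `G`. For contraction to an edge there are two ways used to pair the four ports, and
submodularity of cuts shows that one of them works (`firstPairing_or_secondPairing`). If the second
pairing fails, at most one edge separates its classes outside of `S`, so the forest cannot induce
exactly the partition of the first pairing, and the table for the first pairing may ignore that
state.

Two degenerate cases are settled directly: a single vertex outside of `S` when there are three
ports, and a copy of `S` that spans `G` when there are four. -/

namespace ThreeDec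

open SimpleGraph

/-! ### Balanced trees and 3-decompositions -/

/-- The number of neighbours of a vertex. -/
noncomputable def gdeg {V : Type*} (G : SimpleGraph V) (v : V) : ℕ := (G.neighborSet v).ncard

/-- A spanning tree such that every edge outside the tree joins two vertices of equal degree in the
tree. -/
def HasBalancedTree {V : Type*} (G : SimpleGraph V) : Prop :=
  ∃ T ≤ G, T.IsTree ∧ ∀ u v, G.Adj u v → ¬ T.Adj u v → gdeg T u = gdeg T v

theorem gdeg_pos_of_connected {V : Type*} [Finite V] [Nontrivial V] {T : SimpleGraph V}
    (hT : T.Connected) (v : V) : 0 < gdeg T v := by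
  obtain ⟨w, hw⟩ := hT.preconnected.exists_adj_of_nontrivial v
  exact (Set.ncard_pos (Set.toFinite _)).2 ⟨w, hw⟩

/-- The degrees in the three parts add up to 3, and the tree degree is positive. So a vertex on a
`C`-edge has tree degree 1. A vertex on an `M`-edge has no room for two `C`-edges, so its tree
degree is 2. -/
theorem HasThreeDecomposition.hasBalancedTree {V : Type*} [Finite V] [Nontrivial V]
    {G : SimpleGraph V} (hG : IsCubic G) (h : HasThreeDecomposition G) : HasBalancedTree G := by
  obtain ⟨T, C, M, h⟩ := h
  have htree : T.spanningCoe.IsTree :=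
    (T.spanningCoeEquivCoeOfSpanning h.spanning).isTree_iff.2 h.tree
  refine ⟨T.spanningCoe, T.spanningCoe_le, htree, ?_⟩
  have hC : ∀ v, (C.neighborSet v).ncard = 0 ∨ (C.neighborSet v).ncard = 2 := by
    intro v
    by_cases hv : v ∈ C.verts
    · exact Or.inr (h.two_regular v hv)
    · left
      rw [Set.ncard_eq_zero]
      ext w
      simp only [Subgraph.mem_neighborSet, Set.mem_empty_iff_false, iff_false]
      exact fun hw => hv hw.fst_mem
  have hsum : ∀ v, gdeg T.spanningCoe v + (C.neighborSet v).ncard + (M.neighborSet v).ncard = 3 := by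
    intro v
    have he : ∀ w, G.Adj v w →
        (T.Adj v w ∧ ¬ C.Adj v w ∧ ¬ M.Adj v w) ∨ (¬ T.Adj v w ∧ C.Adj v w ∧ ¬ M.Adj v w) ∨
        (¬ T.Adj v w ∧ ¬ C.Adj v w ∧ M.Adj v w) := fun w hw => by
      simpa only [Subgraph.mem_edgeSet] using h.edges s(v, w) hw
    rw [← hG v, gdeg, ← Set.ncard_union_eq, ← Set.ncard_union_eq]
    · congr 1
      ext w
      simp only [Set.mem_union, mem_neighborSet, Subgraph.mem_neighborSet, Subgraph.spanningCoe_adj]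
      constructor
      · rintro ((hw | hw) | hw) <;> exact hw.adj_sub
      · intro hw
        rcases he w hw with h | h | h <;> tauto
    · rw [Set.disjoint_left]
      rintro w (hw | hw) hw'
      · have := he w (Subgraph.Adj.adj_sub hw')
        simp only [mem_neighborSet, Subgraph.mem_neighborSet, Subgraph.spanningCoe_adj] at hw hw'
        tauto
      · have := he w (Subgraph.Adj.adj_sub hw')
        simp only [Subgraph.mem_neighborSet] at hw hw'
        tauto
    · rw [Set.disjoint_left]
      rintro w hw hw'
      have := he w (Subgraph.Adj.adj_sub hw')
      simp only [mem_neighborSet, Subgraph.mem_neighborSet, Subgraph.spanningCoe_adj] at hw hw'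
      tauto
  have key : ∀ u v, C.Adj u v → gdeg T.spanningCoe u = 1 := by
    intro u v huv
    have h1 := h.two_regular u huv.fst_mem
    have h2 := hsum u
    have h3 := gdeg_pos_of_connected htree.connected u
    omega
  have key' : ∀ u v, M.Adj u v → gdeg T.spanningCoe u = 2 := by
    intro u v huv
    have h1 : (M.neighborSet u).ncard = 1 := by
      obtain ⟨w, hw, hw'⟩ := h.matching huv.fst_mem
      rw [Set.ncard_eq_one]
      exact ⟨w, Set.eq_singleton_iff_unique_mem.2 ⟨hw, hw'⟩⟩
    have h2 := hsum u
    have h3 := gdeg_pos_of_connected htree.connected u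
    have h4 := hC u
    omega
  intro u v huv hnt
  rw [Subgraph.spanningCoe_adj] at hnt
  have := h.edges s(u, v) huv
  simp only [Subgraph.mem_edgeSet] at this
  rcases this with h | h | h
  · exact absurd h.1 hnt
  · rw [key u v h.2.1, key v u h.2.1.symm]
  · rw [key' u v h.2.2, key' v u h.2.2.symm]

theorem HasBalancedTree.hasThreeDecomposition {V : Type*} [Finite V] [Nontrivial V]
    {G : SimpleGraph V} (hG : IsCubic G) (h : HasBalancedTree G) : HasThreeDecomposition G := by
  obtain ⟨T, hTG, hT, hb⟩ := h
  have hsum : ∀ v, gdeg T v + {w | G.Adj v w ∧ ¬ T.Adj v w}.ncard = 3 := by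
    intro v
    rw [← hG v, gdeg, ← Set.ncard_union_eq]
    · congr 1
      ext w
      have := @hTG v w
      simp only [Set.mem_union, mem_neighborSet, Set.mem_ofPred_eq]
      tauto
    · rw [Set.disjoint_left]
      rintro w hw hw'
      exact hw'.2 hw
  -- The non-tree edges between vertices of tree degree `d`. By balance, a vertex of tree degree `d`
  -- keeps all its `3 - d` non-tree edges, so `D 1` is 2-regular and `D 2` is a matching.
  let D : ℕ → G.Subgraph := fun d =>
    { verts := {v | gdeg T v = d}
      Adj := fun u v => G.Adj u v ∧ ¬ T.Adj u v ∧ gdeg T u = d ∧ gdeg T v = d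
      adj_sub := fun h => h.1
      edge_vert := fun h => h.2.2.1
      symm := ⟨fun u v h => ⟨h.1.symm, fun h' => h.2.1 h'.symm, h.2.2.2, h.2.2.1⟩⟩ }
  have hD : ∀ d v, gdeg T v = d → (D d).neighborSet v = {w | G.Adj v w ∧ ¬ T.Adj v w} := by
    intro d v hv
    ext w
    simp only [Subgraph.mem_neighborSet, Set.mem_ofPred_eq, D]
    constructor
    · exact fun h => ⟨h.1, h.2.1⟩
    · exact fun h => ⟨h.1, h.2, hv, (hb v w h.1 h.2).symm.trans hv⟩
  let T' : G.Subgraph :=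
    { verts := Set.univ
      Adj := T.Adj
      adj_sub := fun h => hTG h
      edge_vert := fun _ => trivial
      symm := ⟨fun _ _ h => h.symm⟩ }
  refine ⟨T', D 1, D 2, fun v => trivial, ?_, ?_, ?_, ?_⟩
  · exact (T'.spanningCoeEquivCoeOfSpanning fun v => trivial).isTree_iff.1 hT
  · intro v hv
    rw [hD 1 v hv]
    have := hsum v
    have : gdeg T v = 1 := hv
    omega
  · intro v hv
    have h1 : ((D 2).neighborSet v).ncard = 1 := by
      rw [hD 2 v hv]
      have := hsum v
      have : gdeg T v = 2 := hv
      omega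
    obtain ⟨w, hw⟩ := Set.ncard_eq_one.1 h1
    have hw' : ∀ x, (D 2).Adj v x ↔ x = w := fun x => by
      rw [← Subgraph.mem_neighborSet, hw, Set.mem_singleton_iff]
    exact ⟨w, (hw' w).2 rfl, fun x hx => (hw' x).1 hx⟩
  · intro e
    induction e with
    | _ u v =>
    intro he
    have he : G.Adj u v := he
    simp only [Subgraph.mem_edgeSet, T', D]
    by_cases ht : T.Adj u v
    · tauto
    · have h1 := gdeg_pos_of_connected hT.connected u
      have h2 := hsum u
      have h3 : 0 < {w | G.Adj u w ∧ ¬ T.Adj u w}.ncard :=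
        (Set.ncard_pos (Set.toFinite _)).2 ⟨v, he, ht⟩
      have h4 := hb u v he ht
      have h5 : gdeg T u = 1 ∨ gdeg T u = 2 := by omega
      rcases h5 with h5 | h5 <;> simp [he, ht, h5, ← h4]

/-! ### Edge cuts and 3-connectedness of cubic graphs -/

/-- The number of edges leaving a set of vertices. -/
noncomputable def cut {V : Type*} (G : SimpleGraph V) (A : Set V) : ℕ :=
  {e : V × V | e.1 ∈ A ∧ e.2 ∉ A ∧ G.Adj e.1 e.2}.ncard

/-- At least three edges leave every nonempty proper set of vertices. -/
def EdgeThreeConnected {V : Type*} (G : SimpleGraph V) : Prop :=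
  ∀ A : Set V, A.Nonempty → Aᶜ.Nonempty → 3 ≤ cut G A

theorem cut_compl {V : Type*} (G : SimpleGraph V) (A : Set V) : cut G Aᶜ = cut G A := by
  have : {e : V × V | e.1 ∈ Aᶜ ∧ e.2 ∉ Aᶜ ∧ G.Adj e.1 e.2} =
      Prod.swap '' {e : V × V | e.1 ∈ A ∧ e.2 ∉ A ∧ G.Adj e.1 e.2} := by
    ext ⟨x, y⟩
    simp only [Set.mem_ofPred_eq, Set.mem_compl_iff, not_not, Set.image_swap_eq_preimage_swap,
      Set.mem_preimage, Prod.swap_prod_mk, G.adj_comm x y]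
    tauto
  rw [cut, this, Set.ncard_image_of_injective _ Prod.swap_injective, cut]

/-- Submodularity: a pair that leaves `A ∩ B` or `A ∪ B` leaves `A` or `B`, and a pair that leaves
both of the former leaves both of the latter. -/
theorem cut_inter_add_cut_union_le {V : Type*} [Finite V] (G : SimpleGraph V) (A B : Set V) :
    cut G (A ∩ B) + cut G (A ∪ B) ≤ cut G A + cut G B := by
  unfold cut
  rw [← Set.ncard_union_add_ncard_inter, ← Set.ncard_union_add_ncard_inter
    {e : V × V | e.1 ∈ A ∧ e.2 ∉ A ∧ G.Adj e.1 e.2}]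
  refine add_le_add (Set.ncard_le_ncard ?_ (Set.toFinite _))
    (Set.ncard_le_ncard ?_ (Set.toFinite _)) <;> rintro ⟨x, y⟩ <;>
    simp only [Set.mem_union, Set.mem_inter_iff, Set.mem_ofPred_eq] <;> tauto

theorem not_connected_of_separation {V : Type*} {G : SimpleGraph V} {X A B : Set V}
    (h : (G.induce X).Connected) {a b : V} (ha : a ∈ A) (hb : b ∈ B) (haX : a ∈ X) (hbX : b ∈ X)
    (hX : ∀ x ∈ X, x ∈ A ∨ x ∈ B) (hd : ∀ x ∈ A, x ∉ B)
    (hAB : ∀ x ∈ X, ∀ y ∈ X, x ∈ A → y ∈ B → ¬ G.Adj x y) : False := by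
  obtain ⟨w⟩ := h.preconnected ⟨a, haX⟩ ⟨b, hbX⟩
  obtain ⟨d, -, h1, h2⟩ := w.exists_boundary_dart {x | x.1 ∈ A} ha (fun h' => hd _ h' hb)
  exact hAB _ d.fst.2 _ d.snd.2 h1 ((hX _ d.snd.2).resolve_left h2) d.adj

/-- If fewer than three edges leave `A`, their ends in `A` form a set of at most two vertices that
separates the rest of `A` from the complement, unless it is all of `A`. So `A`, and likewise its
complement, has at most two vertices. Then `G` is `K₄`, where four edges leave a pair. -/
theorem IsKConnected.edgeThreeConnected {V : Type*} [Finite V] {G : SimpleGraph V}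
    (hG : IsCubic G) (h : IsKConnected 3 G) : EdgeThreeConnected G := by
  classical
  have := Fintype.ofFinite V
  by_contra hcon
  simp only [EdgeThreeConnected, not_forall, not_le] at hcon
  obtain ⟨A, hA, hA', hcut⟩ := hcon
  have main : ∀ A : Set V, A.Nonempty → Aᶜ.Nonempty → cut G A < 3 → A.ncard ≤ 2 := by
    intro A hA hA' hcut
    let E := {e : V × V | e.1 ∈ A ∧ e.2 ∉ A ∧ G.Adj e.1 e.2}
    let X := Prod.fst '' E
    have hX : X.ncard < 3 := (Set.ncard_image_le (Set.toFinite _)).trans_lt hcut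
    by_cases hne : (A \ X).Nonempty
    · exfalso
      obtain ⟨a, ha⟩ := hne
      obtain ⟨b, hb⟩ := hA'
      have hXA : X ⊆ A := by
        rintro _ ⟨e, he, rfl⟩
        exact he.1
      have hc := h.2 X.toFinset (by rwa [← Set.ncard_eq_toFinset_card'])
      refine not_connected_of_separation (A := A) (B := Aᶜ) hc ha.1 hb (by simpa using ha.2)
        (by simpa using fun h' => hb (hXA h')) (fun x _ => em _) (fun x hx hx' => hx' hx) ?_
      intro x hx y _ hxA hyA hadj
      simp only [Set.mem_toFinset, Set.mem_ofPred_eq] at hx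
      exact hx ⟨(x, y), ⟨hxA, hyA, hadj⟩, rfl⟩
    · rw [Set.not_nonempty_iff_eq_empty, Set.sdiff_eq_empty] at hne
      have := Set.ncard_le_ncard hne (Set.toFinite _)
      omega
  have h1 := main A hA hA' hcut
  have h2 := main Aᶜ hA' (by simpa using hA) (by rwa [cut_compl])
  have h3 := Set.ncard_add_ncard_compl A
  have h4 := h.1
  have hadj : ∀ a b, a ≠ b → G.Adj a b := by
    intro a b hab
    have h5 : (insert a (G.neighborSet a)).ncard = 4 := by
      rw [Set.ncard_insert_of_notMem (by simp) (Set.toFinite _), hG a]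
    have h6 : insert a (G.neighborSet a) = Set.univ := by
      apply Set.eq_of_subset_of_ncard_le (Set.subset_univ _)
      rw [Set.ncard_univ]
      omega
    have h7 : b ∈ insert a (G.neighborSet a) := h6 ▸ Set.mem_univ b
    rcases h7 with h7 | h7
    · exact absurd h7.symm hab
    · exact h7
  have h5 : A ×ˢ Aᶜ ⊆ {e : V × V | e.1 ∈ A ∧ e.2 ∉ A ∧ G.Adj e.1 e.2} := by
    rintro ⟨x, y⟩ ⟨hx, hy⟩
    exact ⟨hx, hy, hadj x y fun h' => hy (by simpa [← h'] using hx)⟩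
  have h6 := Set.ncard_le_ncard h5 (Set.toFinite _)
  rw [Set.ncard_prod] at h6
  have h7 : A.ncard = 2 := by omega
  have h8 : Aᶜ.ncard = 2 := by omega
  rw [h7, h8] at h6
  exact absurd hcut (by unfold cut; omega)

theorem ncard_prod_singleton {V W : Type*} (s : Set V) (w : W) : (s ×ˢ {w}).ncard = s.ncard := by
  rw [Set.ncard_prod, Set.ncard_singleton, mul_one]

/-- All edges leaving `A` or `B` end in `X`, and each side needs three of them, while a vertex of
`X` has only three edges. This rules out `|X| ≤ 1`. For two vertices all six edges are used, and one
of the two vertices sends at least two of them to `A`. -/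
theorem EdgeThreeConnected.separation_false {V : Type*} [Finite V] {G : SimpleGraph V}
    (hG : IsCubic G) (h : EdgeThreeConnected G) {X : Finset V} (hX : X.card < 3) {A B : Set V}
    (hA : A.Nonempty) (hB : B.Nonempty) (hAB : ∀ x ∈ A, x ∉ B) (hAX : ∀ x ∈ A, x ∉ X)
    (hBX : ∀ x ∈ B, x ∉ X) (hcov : ∀ x, x ∈ A ∨ x ∈ B ∨ x ∈ X)
    (hadj : ∀ x ∈ A, ∀ y ∈ B, ¬ G.Adj x y) : False := by
  classical
  obtain ⟨a, ha⟩ := hA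
  obtain ⟨b, hb⟩ := hB
  have hcA := h A ⟨a, ha⟩ ⟨b, fun h' => hAB b h' hb⟩
  have hcB := h B ⟨b, hb⟩ ⟨a, fun h' => hAB a ha h'⟩
  have hsum : ∀ x, (G.neighborSet x ∩ A).ncard + (G.neighborSet x ∩ B).ncard ≤ 3 := by
    intro x
    rw [← hG x, ← Set.ncard_union_eq]
    · exact Set.ncard_le_ncard (by simp) (Set.toFinite _)
    · rw [Set.disjoint_left]
      exact fun y hy hy' => hAB y hy.2 hy'.2
  have hsubA : {e : V × V | e.1 ∈ A ∧ e.2 ∉ A ∧ G.Adj e.1 e.2} ⊆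
      ⋃ x ∈ X, (G.neighborSet x ∩ A) ×ˢ {x} := by
    rintro ⟨x, y⟩ ⟨h1, h2, h3⟩
    have hy : y ∈ X := by
      rcases hcov y with h4 | h4 | h4
      · exact absurd h4 h2
      · exact absurd h3 (hadj x h1 y h4)
      · exact h4
    simp only [Set.mem_iUnion]
    exact ⟨y, hy, ⟨h3.symm, h1⟩, rfl⟩
  have hsubB : {e : V × V | e.1 ∈ B ∧ e.2 ∉ B ∧ G.Adj e.1 e.2} ⊆
      ⋃ x ∈ X, (G.neighborSet x ∩ B) ×ˢ {x} := by
    rintro ⟨x, y⟩ ⟨h1, h2, h3⟩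
    have hy : y ∈ X := by
      rcases hcov y with h4 | h4 | h4
      · exact absurd h3.symm (hadj y h4 x h1)
      · exact absurd h4 h2
      · exact h4
    simp only [Set.mem_iUnion]
    exact ⟨y, hy, ⟨h3.symm, h1⟩, rfl⟩
  have hA3 := hcA.trans (Set.ncard_le_ncard hsubA (Set.toFinite _))
  have hB3 := hcB.trans (Set.ncard_le_ncard hsubB (Set.toFinite _))
  have hcard : X.card = 0 ∨ X.card = 1 ∨ X.card = 2 := by omega
  rcases hcard with hc | hc | hc
  · rw [Finset.card_eq_zero] at hc
    simp [hc] at hA3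
  · obtain ⟨x, rfl⟩ := Finset.card_eq_one.1 hc
    simp only [Finset.mem_singleton, Set.iUnion_iUnion_eq_left, ncard_prod_singleton] at hA3 hB3
    have := hsum x
    omega
  · obtain ⟨x, y, hxy, rfl⟩ := Finset.card_eq_two.1 hc
    have hU : ∀ C : Set V, (⋃ z ∈ ({x, y} : Finset V), (G.neighborSet z ∩ C) ×ˢ {z}).ncard ≤
        (G.neighborSet x ∩ C).ncard + (G.neighborSet y ∩ C).ncard := by
      intro C
      rw [Finset.set_biUnion_insert, Finset.set_biUnion_singleton]
      refine (Set.ncard_union_le _ _).trans ?_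
      rw [ncard_prod_singleton, ncard_prod_singleton]
    have hA4 := hA3.trans (hU A)
    have hB4 := hB3.trans (hU B)
    -- Moving into `A` the separator vertex with two neighbours there leaves at most one edge at `x`
    -- and at most one at `y` in the cut.
    have move : ∀ x y, (∀ z, z ∈ A ∨ z ∈ B ∨ z = x ∨ z = y) → x ∉ A → x ∉ B →
        2 ≤ (G.neighborSet x ∩ A).ncard → (G.neighborSet y ∩ A).ncard ≤ 1 → False := by
      intro x y hc hxA hxB h1 h2
      have h3 := h (insert x A) ⟨x, by simp⟩ ⟨b, by
        simp only [Set.mem_compl_iff, Set.mem_insert_iff, not_or]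
        exact ⟨fun h' => hxB (h' ▸ hb), fun h' => hAB b h' hb⟩⟩
      have h4 : {e : V × V | e.1 ∈ insert x A ∧ e.2 ∉ insert x A ∧ G.Adj e.1 e.2} ⊆
          (G.neighborSet y ∩ A) ×ˢ {y} ∪ {x} ×ˢ (G.neighborSet x \ A) := by
        rintro ⟨s, t⟩ ⟨h5, h6, h7⟩
        simp only [Set.mem_insert_iff, not_or] at h5 h6 h7
        rcases h5 with rfl | h5
        · exact Or.inr ⟨rfl, h7, h6.2⟩
        · rcases hc t with h8 | h8 | h8 | h8
          · exact absurd h8 h6.2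
          · exact absurd h7 (hadj s h5 t h8)
          · exact absurd h8 h6.1
          · subst h8
            exact Or.inl ⟨⟨h7.symm, h5⟩, rfl⟩
      have h5 := (Set.ncard_le_ncard h4 (Set.toFinite _)).trans (Set.ncard_union_le _ _)
      rw [ncard_prod_singleton, Set.ncard_prod, Set.ncard_singleton, one_mul] at h5
      have h6 := Set.ncard_inter_add_ncard_sdiff_eq_ncard (G.neighborSet x) A (Set.toFinite _)
      rw [hG x] at h6
      unfold cut at h3
      omega
    have h1 := hsum x
    have h2 := hsum y
    by_cases h3 : 2 ≤ (G.neighborSet x ∩ A).ncard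
    · exact move x y (fun z => by simpa using hcov z) (fun h' => hAX x h' (by simp))
        (fun h' => hBX x h' (by simp)) h3 (by omega)
    · exact move y x (fun z => by have := hcov z; simp at this; tauto)
        (fun h' => hAX y h' (by simp)) (fun h' => hBX y h' (by simp)) (by omega) (by omega)

theorem EdgeThreeConnected.isKConnected {V : Type*} [Finite V] [Nonempty V] {G : SimpleGraph V}
    (hG : IsCubic G) (h : EdgeThreeConnected G) : IsKConnected 3 G := by
  classical
  have hV : 3 < Nat.card V := by
    obtain ⟨a⟩ := ‹Nonempty V›
    have h5 : (insert a (G.neighborSet a)).ncard = 4 := by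
      rw [Set.ncard_insert_of_notMem (by simp) (Set.toFinite _), hG a]
    have := Set.ncard_le_card (insert a (G.neighborSet a))
    omega
  refine ⟨hV, fun X hX => ?_⟩
  have hne : ∃ x, x ∉ X := by
    by_contra hcon
    push Not at hcon
    have := Set.ncard_le_ncard (fun x _ => hcon x : (Set.univ : Set V) ⊆ (X : Set V))
      (Set.toFinite _)
    rw [Set.ncard_univ, Set.ncard_coe_finset] at this
    omega
  obtain ⟨x, hx⟩ := hne
  rw [connected_iff_exists_forall_reachable]
  refine ⟨⟨x, hx⟩, fun ⟨y, hy⟩ => ?_⟩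
  by_contra hxy
  refine EdgeThreeConnected.separation_false hG h hX
    (A := {z | ∃ hz : z ∉ X, (G.induce {v | v ∉ X}).Reachable ⟨x, hx⟩ ⟨z, hz⟩})
    (B := {z | ∃ hz : z ∉ X, ¬ (G.induce {v | v ∉ X}).Reachable ⟨x, hx⟩ ⟨z, hz⟩})
    ⟨x, hx, Reachable.refl _⟩ ⟨y, hy, hxy⟩ ?_ (fun z hz => hz.1) (fun z hz => hz.1) ?_ ?_
  · rintro z ⟨hz, h1⟩ ⟨_, h2⟩
    exact h2 h1
  · intro z
    by_cases hz : z ∈ X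
    · tauto
    · by_cases h' : (G.induce {v | v ∉ X}).Reachable ⟨x, hx⟩ ⟨z, hz⟩
      · exact Or.inl ⟨hz, h'⟩
      · exact Or.inr (Or.inl ⟨hz, h'⟩)
  · rintro s ⟨hs, h1⟩ t ⟨ht, h2⟩ hst
    exact h2 (h1.trans (Adj.reachable (by simpa using hst)))

/-! ### Gluing two graphs along ports -/

/-- The graphs `H` and `S` joined by the edges from `o i` to `p i`, for all `i` with `B i`. -/
def glue {β α ι : Type*} (H : SimpleGraph β) (S : SimpleGraph α) (o : ι → β) (p : ι → α)
    (B : ι → Bool) : SimpleGraph (β ⊕ α) where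
  Adj x y := match x, y with
    | .inl u, .inl v => H.Adj u v
    | .inr a, .inr b => S.Adj a b
    | .inl u, .inr a => ∃ i, B i ∧ o i = u ∧ p i = a
    | .inr a, .inl u => ∃ i, B i ∧ o i = u ∧ p i = a
  symm := ⟨by rintro (u | a) (v | b) h <;> first | exact h.symm | exact h⟩
  loopless := ⟨by rintro (u | a) h <;> exact h.ne rfl⟩

section glue

variable {β α ι : Type*} {H : SimpleGraph β} {S : SimpleGraph α} {o : ι → β} {p : ι → α}
  {B : ι → Bool}

@[simp] theorem glue_adj_inl_inl {u v : β} :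
    (glue H S o p B).Adj (.inl u) (.inl v) ↔ H.Adj u v := Iff.rfl

@[simp] theorem glue_adj_inr_inr {a b : α} :
    (glue H S o p B).Adj (.inr a) (.inr b) ↔ S.Adj a b := Iff.rfl

@[simp] theorem glue_adj_inl_inr {u : β} {a : α} :
    (glue H S o p B).Adj (.inl u) (.inr a) ↔ ∃ i, B i ∧ o i = u ∧ p i = a := Iff.rfl

@[simp] theorem glue_adj_inr_inl {u : β} {a : α} :
    (glue H S o p B).Adj (.inr a) (.inl u) ↔ ∃ i, B i ∧ o i = u ∧ p i = a := Iff.rfl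

theorem glue_mono {H' : SimpleGraph β} {S' : SimpleGraph α} {B' : ι → Bool} (hH : H ≤ H')
    (hS : S ≤ S') (hB : ∀ i, B i → B' i) : glue H S o p B ≤ glue H' S' o p B' := by
  rintro (u | a) (v | b) h
  · exact hH h
  · obtain ⟨i, hi, h⟩ := h
    exact ⟨i, hB i hi, h⟩
  · obtain ⟨i, hi, h⟩ := h
    exact ⟨i, hB i hi, h⟩
  · exact hS h

/-- By `hinj` no two ports share both ends, so no port edges merge and each selected port counts
once. -/
theorem gdeg_glue_inl [Finite β] [Fintype ι] [DecidableEq β]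
    (hinj : ∀ i j, o i = o j → p i = p j → i = j) (u : β) :
    gdeg (glue H S o p B) (.inl u) =
      gdeg H u + (Finset.univ.filter fun i => B i ∧ o i = u).card := by
  have h : (glue H S o p B).neighborSet (.inl u) =
      Sum.inl '' H.neighborSet u ∪ Sum.inr '' (p '' {i | B i ∧ o i = u}) := by
    ext (v | a) <;> simp [and_assoc]
  rw [gdeg, h, Set.ncard_union_eq (by rw [Set.disjoint_left]; rintro _ ⟨x, _, rfl⟩ ⟨y, _, h⟩; cases h),
    Set.ncard_image_of_injective _ Sum.inl_injective,
    Set.ncard_image_of_injective _ Sum.inr_injective, Set.InjOn.ncard_image, gdeg,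
    ← Set.ncard_coe_finset]
  · simp
  · rintro i ⟨_, hi⟩ j ⟨_, hj⟩ hij
    exact hinj i j (hi.trans hj.symm) hij

theorem gdeg_glue_inr [Finite α] [Fintype ι] [DecidableEq α]
    (hinj : ∀ i j, o i = o j → p i = p j → i = j) (a : α) :
    gdeg (glue H S o p B) (.inr a) =
      gdeg S a + (Finset.univ.filter fun i => B i ∧ p i = a).card := by
  have h : (glue H S o p B).neighborSet (.inr a) =
      Sum.inr '' S.neighborSet a ∪ Sum.inl '' (o '' {i | B i ∧ p i = a}) := by
    ext (v | a) <;> simp [and_assoc, and_comm]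
  rw [gdeg, h, Set.ncard_union_eq (by rw [Set.disjoint_left]; rintro _ ⟨x, _, rfl⟩ ⟨y, _, h⟩; cases h),
    Set.ncard_image_of_injective _ Sum.inl_injective,
    Set.ncard_image_of_injective _ Sum.inr_injective, Set.InjOn.ncard_image, gdeg,
    ← Set.ncard_coe_finset]
  · simp
  · rintro i ⟨_, hi⟩ j ⟨_, hj⟩ hij
    exact hinj i j hij (hi.trans hj.symm)

theorem sum_gdeg_glue [Fintype ι] [Fintype β] [Fintype α] (hinj : ∀ i j, o i = o j → p i = p j → i = j) :
    ∑ x, gdeg (glue H S o p B) x = ∑ u, gdeg H u + ∑ a, gdeg S a +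
      2 * (Finset.univ.filter fun i => B i).card := by
  classical
  have h1 := Finset.card_eq_sum_card_fiberwise (f := o) (s := Finset.univ.filter fun i => B i)
    (t := Finset.univ) (fun _ _ => Finset.mem_coe.2 (Finset.mem_univ _))
  have h2 := Finset.card_eq_sum_card_fiberwise (f := p) (s := Finset.univ.filter fun i => B i)
    (t := Finset.univ) (fun _ _ => Finset.mem_coe.2 (Finset.mem_univ _))
  simp only [Finset.filter_filter] at h1 h2
  simp only [Fintype.sum_sum_type, gdeg_glue_inl hinj, gdeg_glue_inr hinj,
    Finset.sum_add_distrib]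
  omega

/-- The number of edges of the gluing that leave `A ∪ C`, where parallel edges between the two
parts are counted with multiplicity. -/
noncomputable def glueCut (H : SimpleGraph β) (S : SimpleGraph α) (o : ι → β) (p : ι → α)
    (A : Set β) (C : Set α) : ℕ :=
  cut H A + cut S C + {i | ¬ (o i ∈ A ↔ p i ∈ C)}.ncard

theorem cut_glue [Finite β] [Finite α] [Finite ι]
    (hinj : ∀ i j, o i = o j → p i = p j → i = j) (A : Set β) (C : Set α) :
    cut (glue H S o p fun _ => true) (Sum.inl '' A ∪ Sum.inr '' C) = glueCut H S o p A C := by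
  -- For a port edge with exactly one end in the set, this is the edge directed out of the set.
  let f : ι → (β ⊕ α) × (β ⊕ α) := fun i => by
    classical
    exact if o i ∈ A then (.inl (o i), .inr (p i)) else (.inr (p i), .inl (o i))
  have h : {e : (β ⊕ α) × (β ⊕ α) | e.1 ∈ Sum.inl '' A ∪ Sum.inr '' C ∧
      e.2 ∉ Sum.inl '' A ∪ Sum.inr '' C ∧ (glue H S o p fun _ => true).Adj e.1 e.2} =
      Prod.map Sum.inl Sum.inl '' {e : β × β | e.1 ∈ A ∧ e.2 ∉ A ∧ H.Adj e.1 e.2} ∪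
      Prod.map Sum.inr Sum.inr '' {e : α × α | e.1 ∈ C ∧ e.2 ∉ C ∧ S.Adj e.1 e.2} ∪
      f '' {i | ¬ (o i ∈ A ↔ p i ∈ C)} := by
    ext ⟨x | x, y | y⟩
    · simp only [Set.mem_union, Set.mem_image, Set.mem_ofPred_eq, f]
      constructor
      · rintro ⟨h1, h2, h3⟩
        left; left
        simp at h1 h2
        exact ⟨(x, y), ⟨h1, h2, h3⟩, rfl⟩
      · rintro ((⟨⟨a, b⟩, h1, h2⟩ | ⟨⟨a, b⟩, h1, h2⟩) | ⟨i, h1, h2⟩)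
        · simp only [Prod.map_apply, Prod.mk.injEq, Sum.inl.injEq] at h2
          obtain ⟨rfl, rfl⟩ := h2
          simpa using h1
        · simp at h2
        · split_ifs at h2 <;> simp at h2
    · simp only [Set.mem_union, Set.mem_image, Set.mem_ofPred_eq, f]
      constructor
      · rintro ⟨h1, h2, i, -, rfl, rfl⟩
        right
        simp at h1 h2
        exact ⟨i, by tauto, by simp [h1]⟩
      · rintro ((⟨⟨a, b⟩, h1, h2⟩ | ⟨⟨a, b⟩, h1, h2⟩) | ⟨i, h1, h2⟩)
        · simp at h2
        · simp at h2
        · split_ifs at h2 with h3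
          · simp only [Prod.mk.injEq, Sum.inl.injEq, Sum.inr.injEq] at h2
            obtain ⟨rfl, rfl⟩ := h2
            simp only [h3, true_iff] at h1
            simpa [h3, h1] using ⟨i, rfl, rfl⟩
          · simp at h2
    · simp only [Set.mem_union, Set.mem_image, Set.mem_ofPred_eq, f]
      constructor
      · rintro ⟨h1, h2, i, -, rfl, rfl⟩
        right
        simp at h1 h2
        exact ⟨i, by tauto, by simp [h2]⟩
      · rintro ((⟨⟨a, b⟩, h1, h2⟩ | ⟨⟨a, b⟩, h1, h2⟩) | ⟨i, h1, h2⟩)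
        · simp at h2
        · simp at h2
        · split_ifs at h2 with h3
          · simp at h2
          · simp only [Prod.mk.injEq, Sum.inl.injEq, Sum.inr.injEq] at h2
            obtain ⟨rfl, rfl⟩ := h2
            simp only [h3, false_iff, not_not] at h1
            simpa [h3, h1] using ⟨i, rfl, rfl⟩
    · simp only [Set.mem_union, Set.mem_image, Set.mem_ofPred_eq, f]
      constructor
      · rintro ⟨h1, h2, h3⟩
        left; right
        simp at h1 h2
        exact ⟨(x, y), ⟨h1, h2, h3⟩, rfl⟩
      · rintro ((⟨⟨a, b⟩, h1, h2⟩ | ⟨⟨a, b⟩, h1, h2⟩) | ⟨i, h1, h2⟩)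
        · simp at h2
        · simp only [Prod.map_apply, Prod.mk.injEq, Sum.inr.injEq] at h2
          obtain ⟨rfl, rfl⟩ := h2
          simpa using h1
        · split_ifs at h2 <;> simp at h2
  rw [cut, h, Set.ncard_union_eq, Set.ncard_union_eq, Set.ncard_image_of_injective,
    Set.ncard_image_of_injective, Set.ncard_image_of_injective]
  · rfl
  · intro i j hij
    simp only [f] at hij
    split_ifs at hij <;> simp only [Prod.mk.injEq, Sum.inl.injEq, Sum.inr.injEq, reduceCtorEq,
      and_self] at hij
    · exact hinj i j hij.1 hij.2
    · exact hinj i j hij.2 hij.1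
  · exact Sum.inr_injective.prodMap Sum.inr_injective
  · exact Sum.inl_injective.prodMap Sum.inl_injective
  · rw [Set.disjoint_left]
    rintro _ ⟨⟨a, a'⟩, _, rfl⟩ ⟨⟨b, b'⟩, _, hb⟩
    simp at hb
  · rw [Set.disjoint_left]
    rintro _ (⟨⟨a, a'⟩, _, rfl⟩ | ⟨⟨a, a'⟩, _, rfl⟩) ⟨i, _, hi⟩ <;> simp only [f] at hi <;>
      split_ifs at hi <;> simp at hi

theorem EdgeThreeConnected.three_le_glueCut [Finite β] [Finite α] [Finite ι]
    (hinj : ∀ i j, o i = o j → p i = p j → i = j)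
    (h : EdgeThreeConnected (glue H S o p fun _ => true)) (A : Set β) (C : Set α)
    (h1 : A.Nonempty ∨ C.Nonempty) (h2 : Aᶜ.Nonempty ∨ Cᶜ.Nonempty) :
    3 ≤ glueCut H S o p A C := by
  rw [← cut_glue hinj]
  apply h
  · rcases h1 with ⟨x, hx⟩ | ⟨x, hx⟩
    · exact ⟨.inl x, by simpa using hx⟩
    · exact ⟨.inr x, by simpa using hx⟩
  · rcases h2 with ⟨x, hx⟩ | ⟨x, hx⟩
    · exact ⟨.inl x, by simpa using hx⟩
    · exact ⟨.inr x, by simpa using hx⟩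

theorem edgeThreeConnected_glue [Finite β] [Finite α] [Finite ι]
    (hinj : ∀ i j, o i = o j → p i = p j → i = j)
    (h : ∀ (A : Set β) (C : Set α), A.Nonempty ∨ C.Nonempty → Aᶜ.Nonempty ∨ Cᶜ.Nonempty →
      3 ≤ glueCut H S o p A C) : EdgeThreeConnected (glue H S o p fun _ => true) := by
  intro X h1 h2
  have hX : X = Sum.inl '' (Sum.inl ⁻¹' X) ∪ Sum.inr '' (Sum.inr ⁻¹' X) := by
    ext (x | x) <;> simp
  rw [hX, cut_glue hinj]
  apply h
  · obtain ⟨x | x, hx⟩ := h1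
    · exact Or.inl ⟨x, hx⟩
    · exact Or.inr ⟨x, hx⟩
  · obtain ⟨x | x, hx⟩ := h2
    · exact Or.inl ⟨x, hx⟩
    · exact Or.inr ⟨x, hx⟩

end glue

/-! ### Trees and degree sums -/

theorem sum_gdeg {V : Type*} [Fintype V] (G : SimpleGraph V) :
    ∑ v, gdeg G v = 2 * Nat.card G.edgeSet := by
  classical
  rw [Nat.card_eq_fintype_card, ← edgeFinset_card, ← G.sum_degrees_eq_twice_card_edges]
  refine Finset.sum_congr rfl fun v _ => ?_
  rw [gdeg, Set.ncard_eq_toFinset_card', ← SimpleGraph.card_neighborFinset_eq_degree]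
  rfl

/-- Counting edges through degrees is convenient because degree sums split over the two parts of a
gluing. -/
theorem isTree_iff_connected_and_sum_gdeg {V : Type*} [Fintype V] (G : SimpleGraph V) :
    G.IsTree ↔ G.Connected ∧ ∑ v, gdeg G v + 2 = 2 * Fintype.card V := by
  rw [isTree_iff_connected_and_card, sum_gdeg, Nat.card_eq_fintype_card (α := V)]
  refine and_congr_right fun _ => ?_
  omega

/-! ### Transport along isomorphisms -/

section Iso

variable {V W : Type*} {G : SimpleGraph V} {G' : SimpleGraph W}

theorem gdeg_iso (e : G ≃g G') (v : V) : gdeg G' (e v) = gdeg G v := by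
  have : G'.neighborSet (e v) = e '' G.neighborSet v := by
    ext w
    obtain ⟨w, rfl⟩ := e.surjective w
    simp [Set.mem_image, Iso.map_adj_iff]
  rw [gdeg, this, Set.ncard_image_of_injective _ e.injective, gdeg]

theorem IsCubic.iso (e : G ≃g G') (h : IsCubic G) : IsCubic G' := by
  intro w
  obtain ⟨v, rfl⟩ := e.surjective w
  exact (gdeg_iso e v).trans (h v)

theorem HasBalancedTree.iso (e : G ≃g G') (h : HasBalancedTree G) : HasBalancedTree G' := by
  obtain ⟨T, hTG, hT, hb⟩ := h
  let f : T ≃g T.map e.toEquiv.toEmbedding := Iso.map e.toEquiv T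
  refine ⟨T.map e.toEquiv.toEmbedding, ?_, f.isTree_iff.1 hT, ?_⟩
  · rw [map_le_iff_le_comap]
    intro x y h
    exact e.map_rel_iff.2 (hTG h)
  · intro u v huv hnt
    obtain ⟨u, rfl⟩ := f.surjective u
    obtain ⟨v, rfl⟩ := f.surjective v
    rw [gdeg_iso f, gdeg_iso f]
    rw [f.map_adj_iff] at hnt
    exact hb u v (e.map_rel_iff.1 huv) hnt

theorem EdgeThreeConnected.iso (e : G ≃g G') (h : EdgeThreeConnected G) :
    EdgeThreeConnected G' := by
  intro A hA hA'
  have := h (e ⁻¹' A) (hA.preimage e.surjective) (hA'.preimage e.surjective)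
  have h2 : {x : W × W | x.1 ∈ A ∧ x.2 ∉ A ∧ G'.Adj x.1 x.2} =
      Prod.map e e '' {x : V × V | x.1 ∈ e ⁻¹' A ∧ x.2 ∉ e ⁻¹' A ∧ G.Adj x.1 x.2} := by
    ext ⟨x, y⟩
    obtain ⟨x, rfl⟩ := e.surjective x
    obtain ⟨y, rfl⟩ := e.surjective y
    simp [Iso.map_adj_iff]
  rwa [cut, h2, Set.ncard_image_of_injective _ (e.injective.prodMap e.injective)]

end Iso

/-! ### Finite fragments given by lists of edges -/

/-- The graph on `Fin n` with the given list of edges. -/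
def listGraph (n : ℕ) (L : List (ℕ × ℕ)) : SimpleGraph (Fin n) where
  Adj a b := a ≠ b ∧ ((a.1, b.1) ∈ L ∨ (b.1, a.1) ∈ L)
  symm := ⟨fun _ _ h => ⟨h.1.symm, h.2.symm⟩⟩
  loopless := ⟨fun _ h => h.1 rfl⟩

instance (n : ℕ) (L : List (ℕ × ℕ)) : DecidableRel (listGraph n L).Adj :=
  fun a b => inferInstanceAs (Decidable (a ≠ b ∧ ((a.1, b.1) ∈ L ∨ (b.1, a.1) ∈ L)))

/-- The number of edges of a list at a vertex. -/
def listDeg (L : List (ℕ × ℕ)) (a : ℕ) : ℕ := L.countP fun e => e.1 == a || e.2 == a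

/-- The list describes its graph without repetitions. -/
def IsSimpleList (n : ℕ) (L : List (ℕ × ℕ)) : Prop :=
  (∀ a : Fin n, (Finset.univ.filter fun b => (listGraph n L).Adj a b).card = listDeg L a) ∧
    ∑ a : Fin n, listDeg L a = 2 * L.length

instance (n : ℕ) (L : List (ℕ × ℕ)) : Decidable (IsSimpleList n L) :=
  inferInstanceAs (Decidable (_ ∧ _))

/-- The degree of a vertex of a fragment, counting the ports in `B`. -/
def locDeg {n k : ℕ} (L : List (ℕ × ℕ)) (p : Fin k → Fin n) (B : Fin k → Bool) (a : ℕ) : ℕ :=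
  listDeg L a + (Finset.univ.filter fun i => B i ∧ (p i : ℕ) = a).card

/-- The edges of the graph on `ℕ` in which `L` is joined by the ports in `B` to the outer
components `n + i`, where `i` and `π i` lie in the same component. -/
def quotEdges {n k : ℕ} (L : List (ℕ × ℕ)) (p : Fin k → Fin n) (B : Fin k → Bool)
    (π : Fin k → Fin k) : List (ℕ × ℕ) :=
  L ++ ((List.finRange k).filter fun i => B i).map (fun i => ((p i : ℕ), n + (i : ℕ))) ++
    (List.finRange k).map fun i : Fin k => (n + (i : ℕ), n + (π i : ℕ))

/-- Adds to the vertex set coded by `m` the ends of those edges that meet it, one by one. -/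
def spread (E : List (ℕ × ℕ)) (m : ℕ) : ℕ :=
  E.foldl (fun m e => if m.testBit e.1 || m.testBit e.2 then m ||| 2 ^ e.1 ||| 2 ^ e.2 else m) m

/-- A set of vertices that is reachable from the vertex `0`. -/
def reachSet (E : List (ℕ × ℕ)) : ℕ :=
  spread E (spread E (spread E (spread E (spread E 1))))

/-- The set `reachSet E` contains the first `N` vertices. -/
def Spans (E : List (ℕ × ℕ)) (N : ℕ) : Prop := 2 ^ N - 1 = reachSet E &&& (2 ^ N - 1)

instance (E : List (ℕ × ℕ)) (N : ℕ) : Decidable (Spans E N) := inferInstanceAs (Decidable (_ = _))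

/-- The set `reachSet E` is closed, and does not contain the first `N` vertices. -/
def Separates (E : List (ℕ × ℕ)) (N : ℕ) : Prop :=
  ¬ Spans E N ∧ (reachSet E).testBit 0 ∧
    ∀ e ∈ E, (reachSet E).testBit e.1 = (reachSet E).testBit e.2

instance (E : List (ℕ × ℕ)) (N : ℕ) : Decidable (Separates E N) :=
  inferInstanceAs (Decidable (_ ∧ _))

/-- The sublist selected by the binary digits of a number. -/
def selectList {α : Type*} : List α → ℕ → List α
  | [], _ => []
  | x :: l, m => if m % 2 = 1 then x :: selectList l (m / 2) else selectList l (m / 2)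

/-- The port set coded by a number. -/
def maskBool (k b : ℕ) : Fin k → Bool := fun i => b.testBit i

/-- The number of ports in a port set. -/
def portCount {k : ℕ} (B : Fin k → Bool) : ℕ := (Finset.univ.filter fun i => B i).card

/-- A subcubic graph on `Fin n` with `k` ports, the vertices where it is attached to the rest. -/
structure Fragment (k : ℕ) where
  n : ℕ
  edges : List (ℕ × ℕ)
  port : Fin k → Fin n

namespace Fragment

variable {k : ℕ}

/-- Edges outside of the tree part `L` join vertices of equal degree. -/
def IsBalanced (S : Fragment k) (L : List (ℕ × ℕ)) (B : Fin k → Bool) : Prop :=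
  ∀ e ∈ S.edges, e ∉ L → locDeg L S.port B e.1 = locDeg L S.port B e.2

instance (S : Fragment k) (L : List (ℕ × ℕ)) (B : Fin k → Bool) : Decidable (S.IsBalanced L B) :=
  inferInstanceAs (Decidable (∀ e ∈ S.edges, e ∉ L → _ = _))

/-- The tree part `L` with ports `B` of `S` can take the place of the tree part `L'` with ports `B'`
of `R`, where the outer components are given by `π`. -/
def Replaces (S R : Fragment k) (L L' : List (ℕ × ℕ)) (B B' : Fin k → Bool) (π : Fin k → Fin k) :
    Prop :=
  (∀ i, (B' i → B i) ∧ (B i → B' i ∨ locDeg L' R.port B' (R.port i) = 2) ∧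
    (¬ B i → locDeg L S.port B (S.port i) = locDeg L' R.port B' (R.port i))) ∧
  L.length + portCount B + R.n = L'.length + portCount B' + S.n ∧
  Spans (quotEdges L S.port B π) (S.n + k)

instance (S R : Fragment k) (L L' : List (ℕ × ℕ)) (B B' : Fin k → Bool) (π : Fin k → Fin k) :
    Decidable (S.Replaces R L L' B B' π) :=
  inferInstanceAs (Decidable (_ ∧ _))

/-- The outer components can be joined by fewer edges than those of `L` and `B`. -/
def IsRedundant (R : Fragment k) (L : List (ℕ × ℕ)) (B : Fin k → Bool) (π : Fin k → Fin k) : Prop :=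
  ∃ L' ∈ [[], R.edges], ∃ b < 2 ^ k, L'.length + portCount (maskBool k b) < L.length + portCount B ∧
    Spans (quotEdges L' R.port (maskBool k b) π) (R.n + k)

instance (R : Fragment k) (L : List (ℕ × ℕ)) (B : Fin k → Bool) (π : Fin k → Fin k) :
    Decidable (R.IsRedundant L B π) :=
  inferInstanceAs (Decidable (∃ L' ∈ [[], R.edges], ∃ b < 2 ^ k, _ ∧ _))

/-- The tree parts in a table replace all the tree parts of `R`, whatever the outer components are,
unless these satisfy `excl`. -/
def Covers (S R : Fragment k) (table : List (ℕ × ℕ)) (excl : (Fin k → Fin k) → Bool) : Prop :=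
  ∀ c : Fin (k ^ k), (∀ i, finFunctionFinEquiv.symm c i ≤ i ∧
      finFunctionFinEquiv.symm c (finFunctionFinEquiv.symm c i) = finFunctionFinEquiv.symm c i) →
    excl (finFunctionFinEquiv.symm c) = false →
    ∀ b < 2 ^ k, ∀ L ∈ [[], R.edges], R.IsBalanced L (maskBool k b) →
      Separates (quotEdges L R.port (maskBool k b) (finFunctionFinEquiv.symm c)) (R.n + k) ∨
      (∃ t ∈ table, S.Replaces R (selectList S.edges t.1) L (maskBool k t.2) (maskBool k b)
        (finFunctionFinEquiv.symm c)) ∨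
      R.IsRedundant L (maskBool k b) (finFunctionFinEquiv.symm c)

instance (S R : Fragment k) (table : List (ℕ × ℕ)) (excl : (Fin k → Fin k) → Bool) :
    Decidable (S.Covers R table excl) :=
  by unfold Covers; infer_instance

/-- All members of a table are balanced and free of repetitions. -/
def IsSound (S : Fragment k) (table : List (ℕ × ℕ)) : Prop :=
  ∀ t ∈ table, IsSimpleList S.n (selectList S.edges t.1) ∧
    S.IsBalanced (selectList S.edges t.1) (maskBool k t.2)

instance (S : Fragment k) (table : List (ℕ × ℕ)) : Decidable (S.IsSound table) :=
  by unfold IsSound; infer_instance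

end Fragment

/-- A single vertex with three ports. -/
def vertexFragment : Fragment 3 := ⟨1, [], ![0, 0, 0]⟩

/-- An edge with two ports at each end. -/
def edgeFragment (q : Fin 4 → Fin 2) : Fragment 4 := ⟨2, [(0, 1)], q⟩

/-- Here and in the fragments below, the ports are the vertices of degree two. -/
def triangleFragment : Fragment 3 := ⟨3, [(0, 1), (1, 2), (0, 2)], ![0, 1, 2]⟩

def ktwothreeFragment : Fragment 3 :=
  ⟨5, [(0, 2), (0, 3), (0, 4), (1, 2), (1, 3), (1, 4)], ![2, 3, 4]⟩

/-- The vertex `a` stands for the vertex `a + 1` of the Petersen graph, from which `0` is removed.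
The ports are the former neighbours `1, 4, 5` of `0`. -/
def petersenFragment : Fragment 3 :=
  ⟨9, [(0, 1), (1, 2), (2, 3), (4, 6), (6, 8), (8, 5), (5, 7), (7, 4), (0, 5), (1, 6), (2, 7),
    (3, 8)], ![0, 3, 4]⟩

def clawSquareFragment : Fragment 4 :=
  ⟨8, [(0, 1), (1, 2), (2, 3), (3, 0), (7, 4), (7, 5), (7, 6), (4, 0), (5, 1), (6, 2)],
    ![3, 4, 5, 6]⟩

def twinHouseFragment : Fragment 4 :=
  ⟨6, [(0, 1), (0, 4), (1, 5), (4, 2), (4, 3), (5, 2), (5, 3)], ![0, 1, 2, 3]⟩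

def dominoFragment : Fragment 4 :=
  ⟨6, [(0, 1), (0, 4), (1, 5), (4, 5), (4, 2), (5, 3), (2, 3)], ![0, 1, 2, 3]⟩

/-! ### Soundness of the finite checks -/

theorem testBit_spread {P : ℕ → Prop} {E : List (ℕ × ℕ)} (hE : ∀ e ∈ E, (P e.1 ↔ P e.2)) {m : ℕ}
    (hm : ∀ x, m.testBit x → P x) : ∀ x, (spread E m).testBit x → P x := by
  induction E generalizing m with
  | nil => exact hm
  | cons e E ih =>
    refine ih (fun e he => hE e (List.mem_cons_of_mem _ he)) ?_
    intro x hx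
    have he := hE e List.mem_cons_self
    dsimp only at hx
    split_ifs at hx with h
    · simp only [Nat.testBit_or, Nat.testBit_two_pow, Bool.or_eq_true, decide_eq_true_eq] at hx h
      have h1 : P e.1 := h.elim (hm _) fun h => he.2 (hm _ h)
      rcases hx with (hx | rfl) | rfl
      exacts [hm x hx, h1, he.1 h1]
    · exact hm x hx

/-- Only this direction is needed, and it does not matter whether five passes reach everything:
`Spans` says that all the vertices were reached, and `Separates` contains the test that the set is
closed. -/
theorem testBit_reachSet {P : ℕ → Prop} {E : List (ℕ × ℕ)} (hE : ∀ e ∈ E, (P e.1 ↔ P e.2))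
    (h0 : P 0) : ∀ x, (reachSet E).testBit x → P x := by
  refine testBit_spread hE <| testBit_spread hE <| testBit_spread hE <| testBit_spread hE <|
    testBit_spread hE fun x hx => ?_
  have : x = 0 := by simpa [Nat.testBit_one_eq_true_iff_self_eq_zero] using hx
  exact this ▸ h0

theorem spans_iff {E : List (ℕ × ℕ)} {N : ℕ} :
    Spans E N ↔ ∀ x < N, (reachSet E).testBit x := by
  unfold Spans
  constructor
  · intro h x hx
    have := congrArg (fun m => m.testBit x) h
    simpa [Nat.testBit_two_pow_sub_one, hx] using this
  · intro h
    apply Nat.eq_of_testBit_eq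
    intro x
    by_cases hx : x < N <;> simp [Nat.testBit_two_pow_sub_one, hx, h]

theorem exists_maskBool_eq {k : ℕ} (B : Fin k → Bool) : ∃ b < 2 ^ k, maskBool k b = B :=
  ⟨Nat.ofBits B, Nat.ofBits_lt_two_pow B, funext fun i => Nat.testBit_ofBits_lt B i i.2⟩

theorem mem_of_mem_selectList {α : Type*} {x : α} :
    ∀ {l : List α} {m : ℕ}, x ∈ selectList l m → x ∈ l
  | [], _, h => by simp [selectList] at h
  | y :: l, m, h => by
    rw [selectList] at h
    split_ifs at h
    · rcases List.mem_cons.1 h with rfl | h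
      · exact List.mem_cons_self
      · exact List.mem_cons_of_mem _ (mem_of_mem_selectList h)
    · exact List.mem_cons_of_mem _ (mem_of_mem_selectList h)

theorem listGraph_mono {n : ℕ} {L L' : List (ℕ × ℕ)} (h : ∀ e ∈ L, e ∈ L') :
    listGraph n L ≤ listGraph n L' := fun _ _ hab => ⟨hab.1, hab.2.imp (h _) (h _)⟩

theorem gdeg_listGraph {n : ℕ} {L : List (ℕ × ℕ)} (h : IsSimpleList n L) (a : Fin n) :
    gdeg (listGraph n L) a = listDeg L a := by
  rw [← h.1 a, gdeg, ← Set.ncard_coe_finset]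
  congr 1
  ext b
  simp

theorem sum_gdeg_listGraph {n : ℕ} {L : List (ℕ × ℕ)} (h : IsSimpleList n L) :
    ∑ a, gdeg (listGraph n L) a = 2 * L.length := by
  simp only [gdeg_listGraph h, h.2]

/-! ### Connectivity of a gluing, read off from the quotient by the outer components -/

section Connectivity

variable {β : Type*} {n k : ℕ} {F : SimpleGraph β} {o : Fin k → β} {L : List (ℕ × ℕ)}
  {p : Fin k → Fin n} {B : Fin k → Bool} {π : Fin k → Fin k}

theorem mem_quotEdges {e : ℕ × ℕ} : e ∈ quotEdges L p B π ↔
    e ∈ L ∨ (∃ i, B i ∧ ((p i : ℕ), n + (i : ℕ)) = e) ∨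
      ∃ i : Fin k, (n + (i : ℕ), n + (π i : ℕ)) = e := by
  simp [quotEdges]

/-- The code `n + i` stands for the component of `o i` in `F`. Every edge of the quotient lifts to a
path of the gluing, and by `hhit` no outer vertex is missed. -/
theorem connected_glue (hn : 0 < n) (hL : ∀ e ∈ L, e.1 < n ∧ e.2 < n ∧ e.1 ≠ e.2)
    (hπ : ∀ i, F.Reachable (o i) (o (π i))) (hhit : ∀ v, ∃ i, F.Reachable v (o i))
    (hs : Spans (quotEdges L p B π) (n + k)) : (glue F (listGraph n L) o p B).Connected := by
  set T := glue F (listGraph n L) o p B with hT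
  have hF : ∀ {u v}, F.Reachable u v → T.Reachable (.inl u) (.inl v) := fun h =>
    h.map ⟨Sum.inl, fun h' => h'⟩
  -- Decodes the vertices of the quotient. The last branch is a dummy value for codes from `n + k`
  -- on.
  let vtx : ℕ → β ⊕ Fin n := fun x =>
    if h : x < n then .inr ⟨x, h⟩ else if h : x - n < k then .inl (o ⟨x - n, h⟩) else .inr ⟨0, hn⟩
  have hv1 : ∀ a : Fin n, vtx a = .inr a := fun a => by simp [vtx]
  have hv2 : ∀ i : Fin k, vtx (n + i) = .inl (o i) := fun i => by simp [vtx]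
  have key : ∀ x < n + k, T.Reachable (.inr ⟨0, hn⟩) (vtx x) := by
    intro x hx
    refine testBit_reachSet (P := fun x => T.Reachable (.inr ⟨0, hn⟩) (vtx x)) ?_ ?_ x
      (spans_iff.1 hs x hx)
    · intro e he
      suffices h : T.Reachable (vtx e.1) (vtx e.2) from ⟨fun h' => h'.trans h, fun h' => h'.trans h.symm⟩
      rcases mem_quotEdges.1 he with h | ⟨i, hi, rfl⟩ | ⟨i, rfl⟩
      · obtain ⟨h1, h2, h3⟩ := hL e h
        rw [hv1 ⟨_, h1⟩, hv1 ⟨_, h2⟩]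
        exact Adj.reachable (glue_adj_inr_inr.2 ⟨fun h' => h3 (Fin.mk.inj_iff.1 h'), Or.inl h⟩)
      · rw [hv1, hv2]
        exact Adj.reachable (glue_adj_inr_inl.2 ⟨i, hi, rfl, rfl⟩)
      · rw [hv2, hv2]
        exact hF (hπ i)
    · exact (hv1 ⟨0, hn⟩) ▸ Reachable.refl _
  rw [connected_iff_exists_forall_reachable]
  refine ⟨.inr ⟨0, hn⟩, ?_⟩
  rintro (v | a)
  · obtain ⟨i, hi⟩ := hhit v
    have := key (n + i) (by omega)
    rw [hv2] at this
    exact this.trans (hF hi.symm)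
  · have := key a (by omega)
    rwa [hv1] at this

theorem eq_of_connected {V : Type*} {T : SimpleGraph V} (hT : T.Connected) {P : V → Prop}
    (hP : ∀ u v, T.Adj u v → P u → P v) (u v : V) (hu : P u) : P v := by
  obtain ⟨w⟩ := hT.preconnected u v
  induction w with
  | nil => exact hu
  | cons h _ ih => exact ih (hP _ _ h hu)

/-- A component of `F` without ports would be cut off from the fragment, which is nonempty. -/
theorem exists_reachable_of_connected (hn : 0 < n)
    (hT : (glue F (listGraph n L) o p B).Connected) (v : β) : ∃ i, F.Reachable v (o i) := by
  refine eq_of_connected hT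
    (P := Sum.elim (fun v => ∃ i, F.Reachable v (o i)) fun _ => True) ?_ (.inr ⟨0, hn⟩) (.inl v)
    trivial
  rintro (u | a) (v | b) h
  · rintro ⟨i, hi⟩
    exact ⟨i, (Adj.reachable (glue_adj_inl_inl.1 h)).symm.trans hi⟩
  · exact fun _ => trivial
  · rintro -
    obtain ⟨i, -, rfl, -⟩ := glue_adj_inr_inl.1 h
    exact ⟨i, Reachable.refl _⟩
  · exact fun _ => trivial

/-- A closed set of the quotient lifts to a union of components of the gluing. It contains the
vertex `0`, so by connectedness it is everything. -/
theorem not_separates_of_connected (hn : 0 < n)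
    (hπ : ∀ i j, F.Reachable (o i) (o j) → π i = π j)
    (hT : (glue F (listGraph n L) o p B).Connected) :
    ¬ Separates (quotEdges L p B π) (n + k) := by
  rintro ⟨hs, h0, hcl⟩
  apply hs
  rw [spans_iff]
  have h1 : ∀ i : Fin k, (reachSet (quotEdges L p B π)).testBit (n + i) =
      (reachSet (quotEdges L p B π)).testBit (n + π i) := fun i =>
    hcl (n + (i : ℕ), n + (π i : ℕ)) (mem_quotEdges.2 (Or.inr (Or.inr ⟨i, rfl⟩)))
  have h2 : ∀ i, B i → (reachSet (quotEdges L p B π)).testBit (p i) =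
      (reachSet (quotEdges L p B π)).testBit (n + i) := fun i hi =>
    hcl ((p i : ℕ), n + (i : ℕ)) (mem_quotEdges.2 (Or.inr (Or.inl ⟨i, hi, rfl⟩)))
  set m := reachSet (quotEdges L p B π)
  have h3 : ∀ i j, F.Reachable (o i) (o j) → m.testBit (n + i) = m.testBit (n + j) :=
    fun i j hij => by rw [h1 i, h1 j, hπ i j hij]
  have key := eq_of_connected hT (P := Sum.elim
    (fun v => ∃ i : Fin k, F.Reachable v (o i) ∧ m.testBit (n + i)) fun a => m.testBit a) (by
      rintro (u | a) (v | b) h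
      · rintro ⟨i, hi, hm⟩
        exact ⟨i, (Adj.reachable (glue_adj_inl_inl.1 h)).symm.trans hi, hm⟩
      · rintro ⟨i, hi, hm⟩
        obtain ⟨j, hj, rfl, rfl⟩ := glue_adj_inl_inr.1 h
        simpa [h2 j hj, h3 j i hi] using hm
      · intro hm
        obtain ⟨j, hj, rfl, rfl⟩ := glue_adj_inr_inl.1 h
        exact ⟨j, Reachable.refl _, by simpa [← h2 j hj] using hm⟩
      · intro hm
        obtain ⟨-, h | h⟩ := glue_adj_inr_inr.1 h
        · simpa [← hcl _ (mem_quotEdges.2 (Or.inl h))] using hm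
        · simpa [hcl _ (mem_quotEdges.2 (Or.inl h))] using hm) (.inr ⟨0, hn⟩)
  intro x hx
  by_cases hxn : x < n
  · exact key (.inr ⟨x, hxn⟩) h0
  · obtain ⟨i, hi, hm⟩ := key (.inl (o ⟨x - n, by omega⟩)) h0
    rw [← h3 _ _ hi] at hm
    simpa [Nat.add_sub_cancel' (not_lt.1 hxn)] using hm

end Connectivity

/-- Without injectivity, port edges may coincide, which can only lower degrees. The bound suffices
for refuting redundant states, where a graph has too few edges to be connected. -/
theorem gdeg_glue_inl_le {β α ι : Type*} [Finite β] [Fintype ι] [DecidableEq β]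
    {H : SimpleGraph β} {S : SimpleGraph α} {o : ι → β} {p : ι → α} {B : ι → Bool} (u : β) :
    gdeg (glue H S o p B) (.inl u) ≤
      gdeg H u + (Finset.univ.filter fun i => B i ∧ o i = u).card := by
  have h : (glue H S o p B).neighborSet (.inl u) =
      Sum.inl '' H.neighborSet u ∪ Sum.inr '' (p '' {i | B i ∧ o i = u}) := by
    ext (v | a) <;> simp [and_assoc]
  rw [gdeg, h]
  refine (Set.ncard_union_le _ _).trans (add_le_add (Set.ncard_image_le (Set.toFinite _)) ?_)
  refine (Set.ncard_image_le (Set.toFinite _)).trans ((Set.ncard_image_le (Set.toFinite _)).trans ?_)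
  rw [← Set.ncard_coe_finset]
  simp

theorem gdeg_glue_inr_le {β α ι : Type*} [Finite α] [Fintype ι] [DecidableEq α]
    {H : SimpleGraph β} {S : SimpleGraph α} {o : ι → β} {p : ι → α} {B : ι → Bool} (a : α) :
    gdeg (glue H S o p B) (.inr a) ≤
      gdeg S a + (Finset.univ.filter fun i => B i ∧ p i = a).card := by
  have h : (glue H S o p B).neighborSet (.inr a) =
      Sum.inr '' S.neighborSet a ∪ Sum.inl '' (o '' {i | B i ∧ p i = a}) := by
    ext (v | a) <;> simp [and_assoc, and_comm]
  rw [gdeg, h]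
  refine (Set.ncard_union_le _ _).trans (add_le_add (Set.ncard_image_le (Set.toFinite _)) ?_)
  refine (Set.ncard_image_le (Set.toFinite _)).trans ((Set.ncard_image_le (Set.toFinite _)).trans ?_)
  rw [← Set.ncard_coe_finset]
  simp

theorem sum_gdeg_glue_le {β α ι : Type*} [Fintype β] [Fintype α] [Fintype ι]
    {H : SimpleGraph β} {S : SimpleGraph α} {o : ι → β} {p : ι → α} {B : ι → Bool} :
    ∑ x, gdeg (glue H S o p B) x ≤ ∑ u, gdeg H u + ∑ a, gdeg S a +
      2 * (Finset.univ.filter fun i => B i).card := by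
  classical
  have h1 := Finset.card_eq_sum_card_fiberwise (f := o) (s := Finset.univ.filter fun i => B i)
    (t := Finset.univ) (fun _ _ => Finset.mem_coe.2 (Finset.mem_univ _))
  have h2 := Finset.card_eq_sum_card_fiberwise (f := p) (s := Finset.univ.filter fun i => B i)
    (t := Finset.univ) (fun _ _ => Finset.mem_coe.2 (Finset.mem_univ _))
  simp only [Finset.filter_filter] at h1 h2
  rw [Fintype.sum_sum_type]
  refine (add_le_add (Finset.sum_le_sum fun u _ => gdeg_glue_inl_le u)
    (Finset.sum_le_sum fun a _ => gdeg_glue_inr_le a)).trans ?_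
  simp only [Finset.sum_add_distrib]
  omega

/-! ### Restricting and extending balanced trees -/

/-- The degree of an outer vertex in the forest `F`, counting the ports in `B`. -/
noncomputable def outDeg {β : Type*} {k : ℕ} (F : SimpleGraph β) (o : Fin k → β) (B : Fin k → Bool)
    (u : β) : ℕ :=
  gdeg F u + {i | B i ∧ o i = u}.ncard

namespace Fragment

variable {k : ℕ}

/-- The graph of a fragment. -/
def graph (S : Fragment k) : SimpleGraph (Fin S.n) := listGraph S.n S.edges

/-- The edges of the fragment join distinct vertices and are not repeated. -/
structure IsWellFormed (S : Fragment k) : Prop where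
  pos : 0 < S.n
  bound : ∀ e ∈ S.edges, e.1 < S.n ∧ e.2 < S.n ∧ e.1 ≠ e.2
  simple : IsSimpleList S.n S.edges

/-- The restriction `F` to `H` of a balanced tree of `H` glued to `R`, with the part `L` in `R` and
the edges at the ports in `B`. -/
structure IsOuterTree {β : Type*} [Fintype β] (R : Fragment k) (H : SimpleGraph β) (o : Fin k → β)
    (F : SimpleGraph β) (L : List (ℕ × ℕ)) (B : Fin k → Bool) : Prop where
  le : F ≤ H
  mem : L ∈ [[], R.edges]
  connected : (glue F (listGraph R.n L) o R.port B).Connected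
  count : ∑ u, gdeg F u + 2 * L.length + 2 * portCount B + 2 = 2 * (Fintype.card β + R.n)
  balanced_inner : R.IsBalanced L B
  balanced_outer : ∀ u v, H.Adj u v → ¬ F.Adj u v → outDeg F o B u = outDeg F o B v
  balanced_port : ∀ i, ¬ B i → outDeg F o B (o i) = locDeg L R.port B (R.port i)

theorem isSimpleList_nil (n : ℕ) : IsSimpleList n [] := by
  simp [IsSimpleList, listGraph, listDeg]

/-- The code of a port is the least port in the same component. This normal form leaves one map per
partition of the ports for the finite check. -/
theorem exists_component_code {β : Type*} (F : SimpleGraph β) (o : Fin k → β) :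
    ∃ π : Fin k → Fin k, (∀ i, π i ≤ i ∧ π (π i) = π i) ∧
      ∀ i j, π i = π j ↔ F.Reachable (o i) (o j) := by
  classical
  have hne : ∀ i, (Finset.univ.filter fun j => F.Reachable (o i) (o j)).Nonempty :=
    fun i => ⟨i, by simp⟩
  let π : Fin k → Fin k := fun i => Finset.min' _ (hne i)
  have h1 : ∀ i, F.Reachable (o i) (o (π i)) := fun i => by
    simpa using Finset.min'_mem _ (hne i)
  have h2 : ∀ i j, F.Reachable (o i) (o j) → π i = π j := by
    intro i j hij
    have : (Finset.univ.filter fun l => F.Reachable (o i) (o l)) =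
        Finset.univ.filter fun l => F.Reachable (o j) (o l) := by
      ext l
      simp only [Finset.mem_filter, Finset.mem_univ, true_and]
      exact ⟨hij.symm.trans, hij.trans⟩
    simp only [π, this]
  refine ⟨π, fun i => ⟨Finset.min'_le _ _ (by simp), (h2 _ _ (h1 i)).symm⟩, fun i j => ⟨fun h => ?_, h2 i j⟩⟩
  have := h1 i
  rw [h] at this
  exact this.trans (h1 j).symm

/-- The heart of the reduction: the tree part of `R` is exchanged for one of `S` from the table.
Being spanning in the quotient makes the new graph connected, and the edge count then makes it a
tree. For balance, a port edge outside the old tree either stays outside, with the same tree degree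
at its inner end, or is added to the tree where that degree was 2. In the latter case the outer end
gets degree 3, so that no non-tree edge is left there. -/
theorem IsOuterTree.hasBalancedTree {β : Type*} [Fintype β] {S R : Fragment k}
    {H : SimpleGraph β} {o : Fin k → β} {F : SimpleGraph β} {L : List (ℕ × ℕ)} {B : Fin k → Bool}
    {table : List (ℕ × ℕ)} {excl : (Fin k → Fin k) → Bool} (hS : S.IsWellFormed)
    (hR : R.IsWellFormed) (hsound : S.IsSound table) (hcov : S.Covers R table excl)
    (hp : Function.Injective S.port) (hcubic : IsCubic (glue H S.graph o S.port fun _ => true))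
    (h : R.IsOuterTree H o F L B)
    (hexcl : ∀ π : Fin k → Fin k, (∀ i j, π i = π j ↔ F.Reachable (o i) (o j)) → excl π = false) :
    HasBalancedTree (glue H S.graph o S.port fun _ => true) := by
  classical
  have hinj : ∀ i j, o i = o j → S.port i = S.port j → i = j := fun i j _ h => hp h
  have hdeg : ∀ u, gdeg H u + (Finset.univ.filter fun i => o i = u).card = 3 := by
    intro u
    have h1 := gdeg_glue_inl (H := H) (S := S.graph) (B := fun _ => true) hinj u
    simp only [true_and] at h1
    rw [← h1]
    exact hcubic _
  have hout : ∀ B' u, outDeg F o B' u =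
      gdeg F u + (Finset.univ.filter fun i => B' i ∧ o i = u).card := by
    intro B' u
    rw [outDeg, ← Set.ncard_coe_finset]
    simp
  obtain ⟨π, hπ1, hπ2⟩ := exists_component_code F o
  obtain ⟨b, hb, rfl⟩ := exists_maskBool_eq B
  have hcon := hcov (finFunctionFinEquiv π)
  simp only [Equiv.symm_apply_apply] at hcon
  have hπ3 : ∀ i, F.Reachable (o i) (o (π i)) := fun i => (hπ2 _ _).1 (hπ1 i).2.symm
  have hhit := exists_reachable_of_connected hR.pos h.connected
  -- The first and the last alternative cannot occur for the restriction of a tree: the first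
  -- contradicts connectedness, the last the number of edges.
  rcases hcon hπ1 (hexcl π hπ2) b hb L h.mem h.balanced_inner with h1 | ⟨t, ht, h1⟩ | h1
  · exact absurd h1 (not_separates_of_connected hR.pos (fun i j => (hπ2 i j).2) h.connected)
  · obtain ⟨hsimple, hbal⟩ := hsound t ht
    obtain ⟨hports, hcount, hspans⟩ := h1
    set B := maskBool k b
    set B' := maskBool k t.2
    set L' := selectList S.edges t.1
    have hL' : ∀ e ∈ L', e ∈ S.edges := fun e he => mem_of_mem_selectList he
    have hinl := gdeg_glue_inl (H := F) (S := listGraph S.n L') (B := B') hinj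
    have hinr : ∀ a, gdeg (glue F (listGraph S.n L') o S.port B') (.inr a) =
        locDeg L' S.port B' a := by
      intro a
      rw [gdeg_glue_inr hinj, gdeg_listGraph hsimple, locDeg]
      simp only [Fin.ext_iff]
    -- a port that joins the tree only in `S` is the only edge outside of the tree at its vertex
    have hswitch : ∀ i, B' i → ¬ B i → outDeg F o B (o i) = 2 := by
      intro i hi hi'
      rw [h.balanced_port i hi']
      exact ((hports i).2.1 hi).resolve_left hi'
    have hkeep : ∀ w, (∀ i, o i = w → B' i → B i) → outDeg F o B' w = outDeg F o B w := by
      intro w hw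
      rw [hout, hout]
      congr 2
      ext i
      simp only [Finset.mem_filter, Finset.mem_univ, true_and]
      exact ⟨fun h => ⟨hw i h.2 h.1, h.2⟩, fun h => ⟨(hports i).1 h.1, h.2⟩⟩
    have hFH : ∀ w, gdeg F w ≤ gdeg H w := fun w =>
      Set.ncard_le_ncard (fun x hx => h.le hx) (Set.toFinite _)
    -- If a port edge at `w` were added, `w` would have had tree degree 2 and yet two non-tree
    -- edges: that port edge and `wx`.
    have hkeep1 : ∀ w x, H.Adj w x → ¬ F.Adj w x → outDeg F o B' w = outDeg F o B w := by
      intro w x hwx hwx'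
      refine hkeep w fun i hi hBi => ?_
      by_contra hBi'
      have h2 := hswitch i hBi hBi'
      rw [hi, hout] at h2
      have h3 : gdeg F w < gdeg H w :=
        Set.ncard_lt_ncard ⟨fun x hx => h.le hx, fun h' => hwx' (h' hwx)⟩ (Set.toFinite _)
      have h4 : (Finset.univ.filter fun i => B i ∧ o i = w).card <
          (Finset.univ.filter fun i => o i = w).card := by
        refine Finset.card_lt_card ⟨fun j => by simp, fun h' => ?_⟩
        have := h' (show i ∈ _ by simpa using hi)
        simp at this
        exact hBi' this.1
      have := hdeg w
      omega
    -- The same count with two ports at `o i` outside the old tree: the added port `j`, and `i`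
    -- itself.
    have hkeep2 : ∀ i, ¬ B' i → outDeg F o B' (o i) = outDeg F o B (o i) := by
      intro i hi
      have hi' : ¬ B i := fun h' => hi ((hports i).1 h')
      refine hkeep _ fun j hj hBj => ?_
      by_contra hBj'
      have h2 := hswitch j hBj hBj'
      rw [hj, hout] at h2
      have hij : i ≠ j := fun h' => hi (h' ▸ hBj)
      have h4 : insert i (insert j (Finset.univ.filter fun l => B l ∧ o l = o i)) ⊆
          Finset.univ.filter fun l => o l = o i := by
        intro l hl
        simp only [Finset.mem_insert, Finset.mem_filter, Finset.mem_univ, true_and] at hl ⊢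
        rcases hl with rfl | rfl | hl
        exacts [rfl, hj, hl.2]
      have h5 := Finset.card_le_card h4
      rw [Finset.card_insert_of_notMem (by simp [hij, hi']),
        Finset.card_insert_of_notMem (by simp [hBj'])] at h5
      have := hdeg (o i)
      have := hFH (o i)
      omega
    refine ⟨glue F (listGraph S.n L') o S.port B', glue_mono h.le (listGraph_mono hL')
      (fun _ _ => rfl), ?_, ?_⟩
    · rw [isTree_iff_connected_and_sum_gdeg]
      refine ⟨connected_glue hS.pos (fun e he => hS.bound e (hL' e he)) hπ3 hhit hspans, ?_⟩
      rw [sum_gdeg_glue hinj, sum_gdeg_listGraph hsimple, Fintype.card_sum, Fintype.card_fin]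
      have := h.count
      have h3 : (Finset.univ.filter fun i => B' i).card = portCount B' := rfl
      omega
    · have hcross : ∀ u a, (∃ i, true ∧ o i = u ∧ S.port i = a) →
          (¬ ∃ i, B' i ∧ o i = u ∧ S.port i = a) →
          gdeg (glue F (listGraph S.n L') o S.port B') (.inl u) =
          gdeg (glue F (listGraph S.n L') o S.port B') (.inr a) := by
        rintro u a ⟨i, -, rfl, rfl⟩ hnot
        have hi : ¬ B' i := fun h' => hnot ⟨i, h', rfl, rfl⟩
        have hi' : ¬ B i := fun h' => hi ((hports i).1 h')
        rw [hinl, ← hout, hkeep2 i hi, h.balanced_port i hi', hinr, (hports i).2.2 hi]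
      rintro (u | a) (v | c) hadj hnot
      · rw [hinl, hinl, ← hout, ← hout, hkeep1 u v hadj hnot,
          hkeep1 v u hadj.symm fun h' => hnot h'.symm]
        exact h.balanced_outer u v hadj hnot
      · exact hcross u c (by simpa using hadj) (by simpa using hnot)
      · exact (hcross v a (by simpa using hadj) (by simpa using hnot)).symm
      · rw [hinr, hinr]
        have hnot' : ¬ (listGraph S.n L').Adj a c := hnot
        obtain ⟨hne, hac | hac⟩ := glue_adj_inr_inr.1 hadj
        · exact hbal _ hac fun h' => hnot' ⟨hne, Or.inl h'⟩
        · exact (hbal _ hac fun h' => hnot' ⟨hne, Or.inr h'⟩).symm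
  · obtain ⟨L₁, hL₁, b₁, -, hlt, hspans⟩ := h1
    -- The same outer forest, completed with fewer edges, would give a connected graph with fewer
    -- edges than a tree on these vertices.
    exfalso
    have hsimple : IsSimpleList R.n L₁ := by
      simp only [List.mem_cons, List.not_mem_nil, or_false] at hL₁
      rcases hL₁ with rfl | rfl
      exacts [isSimpleList_nil _, hR.simple]
    have hbound : ∀ e ∈ L₁, e.1 < R.n ∧ e.2 < R.n ∧ e.1 ≠ e.2 := by
      simp only [List.mem_cons, List.not_mem_nil, or_false] at hL₁
      rcases hL₁ with rfl | rfl
      exacts [by simp, hR.bound]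
    have hc := connected_glue hR.pos hbound hπ3 hhit hspans
    have h2 := hc.card_vert_le_card_edgeSet_add_one
    have h3 := sum_gdeg (glue F (listGraph R.n L₁) o R.port (maskBool k b₁))
    have h4 := sum_gdeg_glue_le (H := F) (S := listGraph R.n L₁) (o := o) (p := R.port)
      (B := maskBool k b₁)
    rw [sum_gdeg_listGraph hsimple] at h4
    rw [Nat.card_eq_fintype_card (α := β ⊕ Fin R.n), Fintype.card_sum, Fintype.card_fin] at h2
    have h5 := h.count
    have h6 : (Finset.univ.filter fun i => maskBool k b₁ i).card = portCount (maskBool k b₁) := rfl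
    omega

/-- A subgraph of a gluing is again a gluing of its traces. By `hsub` the trace on `R` has all the
edges of `R` or none. -/
theorem exists_isOuterTree {β : Type*} [Fintype β] {R : Fragment k} {H : SimpleGraph β}
    {o : Fin k → β} (hR : R.IsWellFormed)
    (hinj : ∀ i j, o i = o j → R.port i = R.port j → i = j)
    (hsub : ∀ R' ≤ R.graph, ∃ L ∈ [[], R.edges], R' = listGraph R.n L)
    (h : HasBalancedTree (glue H R.graph o R.port fun _ => true)) :
    ∃ F L B, R.IsOuterTree H o F L B := by
  classical
  obtain ⟨T, hTG, hT, hbal⟩ := h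
  let F : SimpleGraph β := T.comap Sum.inl
  obtain ⟨L, hL, hR'⟩ := hsub (T.comap Sum.inr) fun a b hab => hTG hab
  let B : Fin k → Bool := fun i => decide (T.Adj (.inl (o i)) (.inr (R.port i)))
  have hsimple : IsSimpleList R.n L := by
    simp only [List.mem_cons, List.not_mem_nil, or_false] at hL
    rcases hL with rfl | rfl
    exacts [isSimpleList_nil _, hR.simple]
  have hcross : ∀ u a, T.Adj (.inl u) (.inr a) ↔ ∃ i, B i ∧ o i = u ∧ R.port i = a := by
    intro u a
    constructor
    · intro h
      obtain ⟨i, -, rfl, rfl⟩ := glue_adj_inl_inr.1 (hTG h)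
      exact ⟨i, by simpa [B] using h, rfl, rfl⟩
    · rintro ⟨i, hi, rfl, rfl⟩
      simpa [B] using hi
  have hTeq : T = glue F (listGraph R.n L) o R.port B := by
    ext (u | a) (v | c)
    · rfl
    · exact hcross u c
    · rw [T.adj_comm]
      exact hcross v a
    · rw [glue_adj_inr_inr, ← hR']
      rfl
  have hinl : ∀ u, gdeg T (.inl u) = outDeg F o B u := by
    intro u
    rw [hTeq, gdeg_glue_inl hinj, outDeg, ← Set.ncard_coe_finset]
    simp
  have hinr : ∀ a, gdeg T (.inr a) = locDeg L R.port B a := by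
    intro a
    rw [hTeq, gdeg_glue_inr hinj, gdeg_listGraph hsimple, locDeg]
    simp only [Fin.ext_iff]
  have htree := (isTree_iff_connected_and_sum_gdeg T).1 hT
  refine ⟨F, L, B, fun u v huv => hTG huv, hL, hTeq ▸ hT.connected, ?_, ?_, ?_, ?_⟩
  · have h1 := htree.2
    rw [hTeq, sum_gdeg_glue hinj, sum_gdeg_listGraph hsimple, Fintype.card_sum,
      Fintype.card_fin] at h1
    exact h1
  · intro e he heL
    simp only [List.mem_cons, List.not_mem_nil, or_false] at hL
    rcases hL with rfl | rfl
    · obtain ⟨h1, h2, h3⟩ := hR.bound e he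
      have h4 := hbal (.inr ⟨e.1, h1⟩) (.inr ⟨e.2, h2⟩)
        ⟨fun h' => h3 (Fin.mk.inj_iff.1 h'), Or.inl he⟩ (by
          rw [hTeq, glue_adj_inr_inr]
          simp [listGraph])
      rwa [hinr, hinr] at h4
    · exact absurd he heL
  · intro u v huv hnot
    rw [← hinl, ← hinl]
    exact hbal _ _ huv hnot
  · intro i hi
    rw [← hinl, ← hinr]
    exact hbal _ _ ⟨i, rfl, rfl, rfl⟩ (by simpa [B] using hi)

end Fragment

/-! ### Fragments inside a cubic graph -/

/-- Every vertex of the fragment has degree three if the ports are counted. -/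
def Fragment.IsCubic {k : ℕ} (S : Fragment k) : Prop :=
  ∀ a : Fin S.n, locDeg S.edges S.port (fun _ => true) a = 3

instance {k : ℕ} (S : Fragment k) : Decidable S.IsCubic := by
  unfold Fragment.IsCubic; infer_instance

theorem Fragment.gdeg_graph {k : ℕ} {S : Fragment k} (hS : S.IsWellFormed) (hd : S.IsCubic)
    (a : Fin S.n) : gdeg S.graph a + (Finset.univ.filter fun i => S.port i = a).card = 3 := by
  have h := hd a
  simp only [locDeg, true_and, ← Fin.ext_iff] at h
  rw [Fragment.graph, gdeg_listGraph hS.simple, h]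

/-- In a cubic graph exactly one edge is left over at each port and none elsewhere. Since the copy
need not be induced, this edge may lead back into the copy. -/
theorem Fragment.exists_outer_neighbor {k : ℕ} {S : Fragment k} (hS : S.IsWellFormed)
    (hd : S.IsCubic) (hp : Function.Injective S.port) {V : Type*} [Finite V] {G : SimpleGraph V}
    (hG : ThreeDec.IsCubic G) {f : Fin S.n → V} (hf : Function.Injective f)
    (hfG : ∀ a b, S.graph.Adj a b → G.Adj (f a) (f b)) :
    ∃ x : Fin k → V, (∀ a v, G.Adj (f a) v ↔
      (∃ b, S.graph.Adj a b ∧ f b = v) ∨ ∃ i, S.port i = a ∧ x i = v) ∧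
      ∀ i b, S.graph.Adj (S.port i) b → f b ≠ x i := by
  classical
  have hsub : ∀ a, f '' S.graph.neighborSet a ⊆ G.neighborSet (f a) := by
    rintro a _ ⟨b, hb, rfl⟩
    exact hfG a b hb
  have hcard : ∀ a, (G.neighborSet (f a) \ f '' S.graph.neighborSet a).ncard =
      (Finset.univ.filter fun i => S.port i = a).card := by
    intro a
    have h1 := Fragment.gdeg_graph hS hd a
    have h2 := hG (f a)
    rw [Set.ncard_sdiff (hsub a) (Set.toFinite _), Set.ncard_image_of_injective _ hf, h2]
    unfold gdeg at h1
    omega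
  have hport : ∀ i, ∃ x, G.neighborSet (f (S.port i)) \ f '' S.graph.neighborSet (S.port i) = {x} := by
    intro i
    rw [← Set.ncard_eq_one, hcard, Finset.card_eq_one]
    refine ⟨i, ?_⟩
    ext j
    simp [hp.eq_iff]
  choose x hx using hport
  refine ⟨x, fun a v => ⟨fun h => ?_, ?_⟩, fun i b hb h => ?_⟩
  · by_cases hv : v ∈ f '' S.graph.neighborSet a
    · exact Or.inl hv
    · right
      have hv' : v ∈ G.neighborSet (f a) \ f '' S.graph.neighborSet a := ⟨h, hv⟩
      have h1 : 0 < (Finset.univ.filter fun i => S.port i = a).card := by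
        rw [← hcard]
        exact (Set.ncard_pos (Set.toFinite _)).2 ⟨v, hv'⟩
      obtain ⟨i, hi⟩ := Finset.card_pos.1 h1
      have hi : S.port i = a := by simpa using hi
      subst hi
      rw [hx i] at hv'
      exact ⟨i, rfl, hv'.symm⟩
  · rintro (⟨b, hb, rfl⟩ | ⟨i, rfl, rfl⟩)
    · exact hfG a b hb
    · have : x i ∈ G.neighborSet (f (S.port i)) \ f '' S.graph.neighborSet (S.port i) := by
        rw [hx i]; rfl
      exact this.1
  · have : x i ∈ G.neighborSet (f (S.port i)) \ f '' S.graph.neighborSet (S.port i) := by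
      rw [hx i]; rfl
    exact this.2 ⟨b, hb, h⟩

/-- If some leftover edge joins two ports, at most `k - 2 ≤ 2` edges leave the copy. Then nothing
lies outside, and the leftover edges match all the ports. -/
theorem Fragment.exists_glue_iso_or_surjective {k : ℕ} (hk : k ≤ 4) {S : Fragment k}
    (hS : S.IsWellFormed) (hd : S.IsCubic) (hp : Function.Injective S.port) {V : Type*} [Finite V]
    {G : SimpleGraph V} (hG : ThreeDec.IsCubic G) (h3 : EdgeThreeConnected G) {f : Fin S.n → V}
    (hf : Function.Injective f) (hfG : ∀ a b, S.graph.Adj a b → G.Adj (f a) (f b)) :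
    (∃ o : Fin k → {v // v ∉ Set.range f},
      Nonempty (glue (G.comap (Subtype.val : {v // v ∉ Set.range f} → V)) S.graph o S.port
        (fun _ => true) ≃g G)) ∨
    (Function.Surjective f ∧ ∃ w : Fin k → Fin k, (∀ i, w i ≠ i ∧ w (w i) = i) ∧
      (∀ i, ¬ S.graph.Adj (S.port i) (S.port (w i))) ∧
      ∀ a b, G.Adj (f a) (f b) ↔ S.graph.Adj a b ∨ ∃ i, S.port i = a ∧ S.port (w i) = b) := by
  classical
  obtain ⟨x, hx1, hx2⟩ := Fragment.exists_outer_neighbor hS hd hp hG hf hfG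
  have hin : ∀ i, x i ∈ Set.range f → ∃ j, j ≠ i ∧ x i = f (S.port j) ∧ x j = f (S.port i) := by
    rintro i ⟨b, hb⟩
    have h1 : G.Adj (f (S.port i)) (f b) := (hx1 _ _).2 (Or.inr ⟨i, rfl, hb.symm⟩)
    rcases (hx1 _ _).1 h1.symm with ⟨c, hc, hc'⟩ | ⟨j, rfl, hj⟩
    · rw [hf hc'] at hc
      exact absurd hb (hx2 i b hc.symm)
    · exact ⟨j, fun h => h1.ne (by rw [h]), hb.symm, hj⟩
  by_cases hall : ∀ i, x i ∉ Set.range f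
  · left
    refine ⟨fun i => ⟨x i, hall i⟩, ⟨?_⟩⟩
    let e : {v // v ∉ Set.range f} ⊕ Fin S.n → V := Sum.elim Subtype.val f
    have he : Function.Bijective e := by
      constructor
      · rintro (⟨u, hu⟩ | a) (⟨v, hv⟩ | b) h
        · exact congrArg _ (Subtype.ext h)
        · exact absurd ⟨b, h.symm⟩ hu
        · exact absurd ⟨a, h⟩ hv
        · exact congrArg _ (hf h)
      · intro v
        by_cases hv : v ∈ Set.range f
        · obtain ⟨a, rfl⟩ := hv
          exact ⟨.inr a, rfl⟩
        · exact ⟨.inl ⟨v, hv⟩, rfl⟩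
    have hcross : ∀ (u : {v // v ∉ Set.range f}) a, G.Adj (f a) u ↔
        ∃ i, true ∧ (⟨x i, hall i⟩ : {v // v ∉ Set.range f}) = u ∧ S.port i = a := by
      intro u a
      rw [hx1]
      constructor
      · rintro (⟨b, _, hb⟩ | ⟨i, hi, hi'⟩)
        · exact absurd ⟨b, hb⟩ u.2
        · exact ⟨i, rfl, Subtype.ext hi', hi⟩
      · rintro ⟨i, -, rfl, hi⟩
        exact Or.inr ⟨i, hi, rfl⟩
    refine ⟨Equiv.ofBijective e he, ?_⟩
    rintro (u | a) (v | b)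
    · rfl
    · exact (G.adj_comm _ _).trans (hcross u b)
    · exact hcross v a
    · constructor
      · intro h
        rcases (hx1 a (f b)).1 h with ⟨c, hc, hc'⟩ | ⟨i, _, hi⟩
        · rwa [hf hc'] at hc
        · exact absurd ⟨b, hi.symm⟩ (hall i)
      · exact hfG a b
  · right
    push Not at hall
    obtain ⟨i, hi⟩ := hall
    obtain ⟨j, hji, hij, hji'⟩ := hin i hi
    have hsurj : Function.Surjective f := by
      by_contra hns
      have hne : (Set.range f)ᶜ.Nonempty := by
        rw [Set.nonempty_compl]
        exact fun h => hns (Set.range_eq_univ.1 h)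
      have hcut := h3 (Set.range f) ⟨f ⟨0, hS.pos⟩, _, rfl⟩ hne
      have hsub : {e : V × V | e.1 ∈ Set.range f ∧ e.2 ∉ Set.range f ∧ G.Adj e.1 e.2} ⊆
          (fun l => (f (S.port l), x l)) '' ((Finset.univ \ {i, j} : Finset (Fin k)) : Set (Fin k)) := by
        rintro ⟨_, v⟩ ⟨⟨a, rfl⟩, hv, hav⟩
        rcases (hx1 a v).1 hav with ⟨b, _, hb⟩ | ⟨l, rfl, rfl⟩
        · exact absurd ⟨b, hb⟩ hv
        · refine ⟨l, ?_, rfl⟩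
          simp only [Finset.coe_sdiff, Finset.coe_univ, Set.mem_sdiff, Set.mem_univ, true_and,
            Finset.mem_coe, Finset.mem_insert, Finset.mem_singleton]
          rintro (rfl | rfl)
          · exact hv hi
          · exact hv ⟨_, hji'.symm⟩
      have h1 := (Set.ncard_le_ncard hsub (Set.toFinite _)).trans (Set.ncard_image_le (Set.toFinite _))
      rw [Set.ncard_coe_finset, Finset.card_univ_sdiff, Finset.card_pair hji.symm,
        Fintype.card_fin] at h1
      unfold cut at hcut
      omega
    refine ⟨hsurj, ?_⟩
    choose w hw using fun i => hin i (hsurj (x i))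
    refine ⟨w, fun i => ⟨(hw i).1, ?_⟩, fun i h => ?_, fun a b => ?_⟩
    · have h1 := (hw (w i)).2.1
      rw [(hw i).2.2] at h1
      exact (hp (hf h1)).symm
    · exact hx2 i _ h (hw i).2.1.symm
    · rw [hx1]
      refine or_congr ⟨?_, fun h => ⟨b, h, rfl⟩⟩ (exists_congr fun i => and_congr_right fun _ => ?_)
      · rintro ⟨c, hc, hc'⟩
        rwa [hf hc'] at hc
      · rw [(hw i).2.1, hf.eq_iff]

/-! ### Copies of a fragment that span the graph -/

/-- If the ports of `S` are joined to each other, a tree part from the table is a balanced tree. -/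
def Fragment.ClosesUp {k : ℕ} (S : Fragment k) (table : List ℕ) : Prop :=
  ∀ c : Fin (k ^ k), (∀ i, finFunctionFinEquiv.symm c i ≠ i ∧
      finFunctionFinEquiv.symm c (finFunctionFinEquiv.symm c i) = i) →
    (∀ i, ¬ (listGraph S.n S.edges).Adj (S.port i) (S.port (finFunctionFinEquiv.symm c i))) →
    ∃ t ∈ table, IsSimpleList S.n (selectList S.edges t) ∧
      S.IsBalanced (selectList S.edges t) (fun _ => false) ∧
      (∀ i, listDeg (selectList S.edges t) (S.port i) =
        listDeg (selectList S.edges t) (S.port (finFunctionFinEquiv.symm c i))) ∧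
      (selectList S.edges t).length + 1 = S.n ∧ Spans (selectList S.edges t) S.n

instance {k : ℕ} (S : Fragment k) (table : List ℕ) : Decidable (S.ClosesUp table) := by
  unfold Fragment.ClosesUp; infer_instance

theorem connected_listGraph {n : ℕ} {L : List (ℕ × ℕ)} (hn : 0 < n)
    (hL : ∀ e ∈ L, e.1 < n ∧ e.2 < n ∧ e.1 ≠ e.2) (hs : Spans L n) :
    (listGraph n L).Connected := by
  rw [connected_iff_exists_forall_reachable]
  refine ⟨⟨0, hn⟩, fun a => ?_⟩
  have := testBit_reachSet (P := fun x => ∃ h : x < n, (listGraph n L).Reachable ⟨0, hn⟩ ⟨x, h⟩)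
    (E := L) (fun e he => ?_) ⟨hn, Reachable.refl _⟩ a (spans_iff.1 hs a a.2)
  · exact this.2
  · obtain ⟨h1, h2, h3⟩ := hL e he
    have h4 : (listGraph n L).Reachable ⟨e.1, h1⟩ ⟨e.2, h2⟩ :=
      Adj.reachable ⟨fun h' => h3 (Fin.mk.inj_iff.1 h'), Or.inl he⟩
    exact ⟨fun ⟨_, h⟩ => ⟨h2, h.trans h4⟩, fun ⟨_, h⟩ => ⟨h1, h.trans h4.symm⟩⟩

/-- The tree uses edges of `S` only. The edges between ports are all outside the tree, so matched
ports must have equal tree degree. -/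
theorem Fragment.hasBalancedTree_of_closesUp {k : ℕ} {S : Fragment k} (hS : S.IsWellFormed)
    {table : List ℕ} (ht : S.ClosesUp table) {V : Type*} {G : SimpleGraph V} {f : Fin S.n → V}
    (hf : Function.Bijective f) {w : Fin k → Fin k} (hw : ∀ i, w i ≠ i ∧ w (w i) = i)
    (hw' : ∀ i, ¬ S.graph.Adj (S.port i) (S.port (w i)))
    (hG : ∀ a b, G.Adj (f a) (f b) ↔ S.graph.Adj a b ∨ ∃ i, S.port i = a ∧ S.port (w i) = b) :
    HasBalancedTree G := by
  have h := ht (finFunctionFinEquiv w)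
  simp only [Equiv.symm_apply_apply] at h
  obtain ⟨t, -, h1, h2, h3, h4, h5⟩ := h hw hw'
  let e : G.comap f ≃g G := ⟨Equiv.ofBijective f hf, Iff.rfl⟩
  refine HasBalancedTree.iso e ⟨listGraph S.n (selectList S.edges t), ?_, ?_, ?_⟩
  · intro a b hab
    exact (hG a b).2 (Or.inl (listGraph_mono (fun _ he => mem_of_mem_selectList he) hab))
  · rw [isTree_iff_connected_and_sum_gdeg]
    refine ⟨connected_listGraph hS.pos (fun e he => hS.bound e (mem_of_mem_selectList he)) h5, ?_⟩
    rw [sum_gdeg_listGraph h1, Fintype.card_fin]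
    omega
  · intro a b hab hnot
    rw [gdeg_listGraph h1, gdeg_listGraph h1]
    have h6 : ∀ e ∈ S.edges, e ∉ selectList S.edges t →
        listDeg (selectList S.edges t) e.1 = listDeg (selectList S.edges t) e.2 :=
      fun e he he' => by simpa [locDeg] using h2 e he he'
    rcases (hG a b).1 hab with ⟨hne, h7 | h7⟩ | ⟨i, rfl, rfl⟩
    · exact h6 _ h7 fun h' => hnot ⟨hne, Or.inl h'⟩
    · exact (h6 _ h7 fun h' => hnot ⟨hne, Or.inr h'⟩).symm
    · exact h3 i

/-! ### Replacing a fragment -/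

section Replace

variable {β : Type*} {k : ℕ} {H : SimpleGraph β} {o : Fin k → β}

theorem cut_empty {V : Type*} (G : SimpleGraph V) : cut G ∅ = 0 := by simp [cut]

theorem cut_univ {V : Type*} (G : SimpleGraph V) : cut G Set.univ = 0 := by simp [cut]

theorem glueCut_empty {α : Type*} (S : SimpleGraph α) (p : Fin k → α) (A : Set β) :
    glueCut H S o p A ∅ = cut H A + {i | o i ∈ A}.ncard := by
  simp [glueCut, cut_empty]

theorem glueCut_univ {α : Type*} (S : SimpleGraph α) (p : Fin k → α) (A : Set β) :
    glueCut H S o p A Set.univ = cut H A + {i | o i ∉ A}.ncard := by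
  simp [glueCut, cut_univ]

theorem cut_singleton (u : β) : cut H {u} = gdeg H u := by
  have : {e : β × β | e.1 ∈ ({u} : Set β) ∧ e.2 ∉ ({u} : Set β) ∧ H.Adj e.1 e.2} =
      Prod.mk u '' H.neighborSet u := by
    ext ⟨x, y⟩
    simp only [Set.mem_singleton_iff, Set.mem_ofPred_eq, Set.mem_image, mem_neighborSet,
      Prod.mk.injEq]
    constructor
    · rintro ⟨rfl, -, h⟩
      exact ⟨y, h, rfl, rfl⟩
    · rintro ⟨y, h, rfl, rfl⟩
      exact ⟨rfl, h.ne', h⟩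
  rw [cut, this, Set.ncard_image_of_injective _ (Prod.mk_right_injective u), gdeg]

theorem Fragment.isCubic_glue [Finite β] {R : Fragment k} (hR : R.IsWellFormed) (hd : R.IsCubic)
    (hinj : ∀ i j, o i = o j → R.port i = R.port j → i = j)
    (hdeg : ∀ u, gdeg H u + {i | o i = u}.ncard = 3) :
    ThreeDec.IsCubic (glue H R.graph o R.port fun _ => true) := by
  classical
  rintro (u | a)
  · refine (gdeg_glue_inl hinj u).trans ?_
    rw [← hdeg u, ← Set.ncard_coe_finset]
    simp
  · refine (gdeg_glue_inr hinj a).trans ?_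
    simpa using Fragment.gdeg_graph hR hd a

theorem Fragment.gdeg_add_ncard_eq_three [Finite β] {S : Fragment k}
    (hp : Function.Injective S.port)
    (h : ThreeDec.IsCubic (glue H S.graph o S.port fun _ => true)) (u : β) :
    gdeg H u + {i | o i = u}.ncard = 3 := by
  classical
  rw [← h (.inl u)]
  refine Eq.trans ?_ (gdeg_glue_inl (fun i j _ h => hp h) u).symm
  rw [← Set.ncard_coe_finset]
  simp

end Replace

/-- Everything that is needed to replace a fragment in a minimal counterexample. -/
structure Fragment.IsReducibleTo {k : ℕ} (S R : Fragment k) (table : List (ℕ × ℕ))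
    (excl : (Fin k → Fin k) → Bool) : Prop where
  sound : S.IsSound table
  covers : S.Covers R table excl

/-- The gluing with `R` is cubic, 3-connected and smaller, so it has a balanced tree by minimality.
Exchanging the part in `R` yields a balanced tree of `G`. -/
theorem Fragment.replace {k : ℕ} {S R : Fragment k} {table : List (ℕ × ℕ)}
    {excl : (Fin k → Fin k) → Bool} (hS : S.IsWellFormed) (hR : R.IsWellFormed)
    (hdR : R.IsCubic) (hSR : S.IsReducibleTo R table excl) (hp : Function.Injective S.port)
    (hlt : R.n < S.n) (hsub : ∀ R' ≤ R.graph, ∃ L ∈ [[], R.edges], R' = listGraph R.n L)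
    {V : Type u} [Finite V] {G : SimpleGraph V} (hG : IsMinimalThreeConnectedCounterexample G)
    {β : Type u} [Finite β] {H : SimpleGraph β} {o : Fin k → β}
    (e : glue H S.graph o S.port (fun _ => true) ≃g G)
    (hinj : ∀ i j, o i = o j → R.port i = R.port j → i = j)
    (h3 : EdgeThreeConnected (glue H R.graph o R.port fun _ => true))
    (hexcl : ∀ F ≤ H, ∀ π : Fin k → Fin k, (∀ i j, π i = π j ↔ F.Reachable (o i) (o j)) →
      excl π = false) : False := by
  have := Fintype.ofFinite β
  have hcub := IsCubic.iso e.symm hG.1.1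
  have hdeg := Fragment.gdeg_add_ncard_eq_three hp hcub
  have hcubR := Fragment.isCubic_glue hR hdR hinj hdeg
  have : Nontrivial V := by
    have := hG.1.2.1.1
    rw [← Finite.one_lt_card_iff_nontrivial]
    omega
  have : Nonempty (Fin R.n) := ⟨⟨0, hR.pos⟩⟩
  have hconR := EdgeThreeConnected.isKConnected hcubR h3
  have : Nontrivial (β ⊕ Fin R.n) := by
    have := hconR.1
    rw [← Finite.one_lt_card_iff_nontrivial]
    omega
  have hdec : HasThreeDecomposition (glue H R.graph o R.port fun _ => true) := by
    by_contra hno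
    have h1 := hG.2 _ _ ⟨hcubR, hconR, hno⟩
    rw [← Nat.card_congr e.toEquiv, Nat.card_sum, Nat.card_sum, Nat.card_eq_fintype_card (α := Fin _),
      Nat.card_eq_fintype_card (α := Fin _), Fintype.card_fin, Fintype.card_fin] at h1
    omega
  obtain ⟨F, L, B, hF⟩ := Fragment.exists_isOuterTree hR hinj hsub (hdec.hasBalancedTree hcubR)
  have h1 := hF.hasBalancedTree hS hR hSR.sound hSR.covers hp hcub (hexcl F hF.le)
  exact hG.1.2.2 ((h1.iso e).hasThreeDecomposition hG.1.1)

/-! ### Three ports: contraction to a vertex -/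

theorem vertexFragment_isWellFormed : vertexFragment.IsWellFormed :=
  ⟨by decide, by decide, by decide⟩

theorem exists_eq_listGraph_of_le_vertexFragment :
    ∀ R' ≤ vertexFragment.graph, ∃ L ∈ [[], vertexFragment.edges],
      R' = listGraph vertexFragment.n L := by
  intro R' _
  refine ⟨[], by simp, ?_⟩
  ext a b
  have : a = b := Subsingleton.elim (α := Fin 1) a b
  simp [this]

theorem ncard_add_ncard_not {ι : Type*} [Finite ι] (P : ι → Prop) :
    {i | P i}.ncard + {i | ¬ P i}.ncard = Nat.card ι :=
  Set.ncard_add_ncard_compl {i | P i}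

/-- The part of a balanced tree outside of a fragment with only one vertex outside. -/
theorem isOuterTree_of_subsingleton {β : Type*} [Fintype β] [Subsingleton β] (H : SimpleGraph β)
    (o : Fin 3 → β) : vertexFragment.IsOuterTree H o ⊥ [] fun i => decide (i = 0) := by
  have ho : ∀ i u, o i = u := fun i u => Subsingleton.elim _ _
  have hb : ∀ u, gdeg (⊥ : SimpleGraph β) u = 0 := fun u => by simp [gdeg]
  refine ⟨bot_le, by simp, ?_, ?_, by decide, ?_, ?_⟩
  · rw [connected_iff_exists_forall_reachable]
    refine ⟨.inl (o 0), ?_⟩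
    rintro (u | a)
    · rw [ho 0 u]
    · exact Adj.reachable (glue_adj_inl_inr.2 ⟨0, rfl, rfl, Subsingleton.elim (α := Fin 1) _ _⟩)
  · have : Fintype.card β = 1 := Fintype.card_eq_one_iff.2 ⟨o 0, fun u => (ho 0 u).symm⟩
    rw [this]
    simp only [hb, Finset.sum_const_zero]
    decide
  · intro u v huv
    exact absurd (Subsingleton.elim u v) huv.ne
  · intro i _
    have h1 : {j | decide (j = 0) ∧ o j = o i} = {(0 : Fin 3)} := by
      ext j
      simp [ho j (o i)]
    rw [outDeg, hb, h1, Set.ncard_singleton]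
    have h2 : ∀ i, 0 + 1 = locDeg [] vertexFragment.port (fun i => decide (i = 0))
        (vertexFragment.port i) := by decide
    exact h2 i

/-- A vertex set of the contraction contains the new vertex or not, so its cut is a cut of `G` with
all of the fragment on one side. -/
theorem Fragment.not_contained_of_three_ports {S : Fragment 3} {table : List (ℕ × ℕ)}
    (hS : S.IsWellFormed) (hd : S.IsCubic) (hp : Function.Injective S.port) (hlt : 1 < S.n)
    (hred : S.IsReducibleTo vertexFragment table fun _ => false) {V : Type u} [Finite V]
    {G : SimpleGraph V} (hG : IsMinimalThreeConnectedCounterexample G) {f : Fin S.n → V}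
    (hf : Function.Injective f) (hfG : ∀ a b, S.graph.Adj a b → G.Adj (f a) (f b)) : False := by
  have h3 := hG.1.2.1.edgeThreeConnected hG.1.1
  rcases Fragment.exists_glue_iso_or_surjective (by norm_num) hS hd hp hG.1.1 h3 hf hfG with
    ⟨o, ⟨e⟩⟩ | ⟨-, w, hw, -⟩
  · set H := G.comap (Subtype.val : {v // v ∉ Set.range f} → V)
    have := Fintype.ofFinite {v // v ∉ Set.range f}
    have hcub := IsCubic.iso e.symm hG.1.1
    have hcut := (h3.iso e.symm).three_le_glueCut fun i j _ h => hp h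
    have hdeg := Fragment.gdeg_add_ncard_eq_three hp hcub
    have hempty : ∀ A : Set {v // v ∉ Set.range f}, A.Nonempty →
        3 ≤ cut H A + {i | o i ∈ A}.ncard := by
      intro A hA
      rw [← glueCut_empty S.graph S.port]
      exact hcut _ _ (Or.inl hA) (Or.inr ⟨⟨0, hS.pos⟩, by simp⟩)
    have huniv : ∀ A : Set {v // v ∉ Set.range f}, Aᶜ.Nonempty →
        3 ≤ cut H A + {i | o i ∉ A}.ncard := by
      intro A hA
      rw [← glueCut_univ S.graph S.port]
      exact hcut _ _ (Or.inr ⟨⟨0, hS.pos⟩, by simp⟩) (Or.inl hA)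
    rcases subsingleton_or_nontrivial {v // v ∉ Set.range f} with hβ | hβ
    · have : Nontrivial V := by
        have := hG.1.2.1.1
        rw [← Finite.one_lt_card_iff_nontrivial]
        omega
      -- Contraction would leave two vertices joined by three parallel edges, which is not a simple
      -- graph. One of these edges still serves as the outer tree.
      have h1 := (isOuterTree_of_subsingleton H o).hasBalancedTree hS vertexFragment_isWellFormed
        hred.sound hred.covers hp hcub fun _ _ => rfl
      exact hG.1.2.2 ((h1.iso e).hasThreeDecomposition hG.1.1)
    · have hinj : ∀ i j, o i = o j → vertexFragment.port i = vertexFragment.port j → i = j := by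
        intro i j hij _
        by_contra hne
        -- If `m` ports end at `o i`, then `(3 - m) + (3 - m)` edges leave the fragment together
        -- with `o i`, which is less than three for `m ≥ 2`.
        have h1 := huniv {o i} (by
          obtain ⟨v, hv⟩ := exists_ne (o i)
          exact ⟨v, hv⟩)
        have h2 := hdeg (o i)
        have h4 : 1 < {l | o l = o i}.ncard :=
          (Set.one_lt_ncard (Set.toFinite _)).2 ⟨i, rfl, j, hij.symm, hne⟩
        have h5 := ncard_add_ncard_not fun l => o l = o i
        rw [cut_singleton] at h1
        simp only [Set.mem_singleton_iff] at h1
        rw [Nat.card_eq_fintype_card, Fintype.card_fin] at h5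
        omega
      refine Fragment.replace hS vertexFragment_isWellFormed (by decide) hred hp hlt
        exists_eq_listGraph_of_le_vertexFragment hG e hinj ?_ fun _ _ _ _ => rfl
      refine edgeThreeConnected_glue hinj fun A C h1 h2 => ?_
      rcases Set.eq_empty_or_nonempty C with rfl | hC
      · rw [glueCut_empty]
        exact hempty A (by simpa using h1)
      · have : C = Set.univ := by
          obtain ⟨c, hc⟩ := hC
          refine Set.eq_univ_of_forall fun x => ?_
          rwa [show x = c from Subsingleton.elim (α := Fin 1) x c]
        subst this
        rw [glueCut_univ]
        exact huniv A (by simpa using h2)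
  · have : ∀ w : Fin 3 → Fin 3, ¬ ∀ i, w i ≠ i ∧ w (w i) = i := by decide
    exact this w hw

/-! ### Four ports: contraction to an edge -/

theorem edgeFragment_isWellFormed (q : Fin 4 → Fin 2) : (edgeFragment q).IsWellFormed :=
  ⟨by simp [edgeFragment], by simp [edgeFragment],
    show IsSimpleList 2 [(0, 1)] by decide⟩

theorem exists_eq_listGraph_of_le_edgeFragment (q : Fin 4 → Fin 2) :
    ∀ R' ≤ (edgeFragment q).graph, ∃ L ∈ [[], (edgeFragment q).edges],
      R' = listGraph (edgeFragment q).n L := by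
  intro R' hR'
  change SimpleGraph (Fin 2) at R'
  change R' ≤ listGraph 2 [(0, 1)] at hR'
  by_cases h : R'.Adj 0 1
  · refine ⟨[(0, 1)], by simp [edgeFragment], ?_⟩
    refine le_antisymm hR' ?_
    change listGraph 2 [(0, 1)] ≤ R'
    intro a b hab
    have : ∀ a b : Fin 2, (listGraph 2 [(0, 1)]).Adj a b → a = 0 ∧ b = 1 ∨ a = 1 ∧ b = 0 := by
      decide
    rcases this a b hab with ⟨rfl, rfl⟩ | ⟨rfl, rfl⟩
    exacts [h, h.symm]
  · refine ⟨[], by simp, ?_⟩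
    change R' = listGraph 2 []
    ext a b
    have : ∀ a b : Fin 2, (listGraph 2 [(0, 1)]).Adj a b → a = 0 ∧ b = 1 ∨ a = 1 ∧ b = 0 := by
      decide
    constructor
    · intro hab
      rcases this a b (hR' hab) with ⟨rfl, rfl⟩ | ⟨rfl, rfl⟩
      exacts [absurd hab h, absurd hab.symm h]
    · simp [listGraph]

/-- The ports `0, 1` are separated from the ports `2, 3`. -/
def firstPairing : Fin 4 → Fin 2 := ![0, 0, 1, 1]

/-- The ports `0, 2` are separated from the ports `1, 3`. -/
def secondPairing : Fin 4 → Fin 2 := ![0, 1, 0, 1]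

/-- The outer components join exactly the ports `0, 1` and the ports `2, 3`. -/
def joinsFirstPairing (π : Fin 4 → Fin 4) : Bool :=
  decide (π 0 = π 1 ∧ π 2 = π 3 ∧ π 0 ≠ π 2)

theorem one_le_cut_edge {C : Set (Fin 2)} (h0 : 0 ∈ C) (h1 : 1 ∉ C) :
    1 ≤ cut (listGraph 2 [(0, 1)]) C :=
  (Set.ncard_pos (Set.toFinite _)).2 ⟨(0, 1), h0, h1,
    show (listGraph 2 [(0, 1)]).Adj 0 1 by decide⟩

theorem ncard_eq_card_filter {ι : Type*} [Fintype ι] (P : ι → Prop) [DecidablePred P] :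
    {i | P i}.ncard = (Finset.univ.filter P).card := by
  rw [← Set.ncard_coe_finset]
  simp

section Pairing

variable {β : Type*} {H : SimpleGraph β} {o : Fin 4 → β} {q : Fin 4 → Fin 2}

/-- No set with at most one leaving edge separates the two classes of `q`. -/
def IsGoodPairing (H : SimpleGraph β) (o : Fin 4 → β) (q : Fin 4 → Fin 2) : Prop :=
  ∀ A : Set β, (∀ i, o i ∈ A ↔ q i = 0) → 2 ≤ cut H A

/-- If `A` splits the ports differently from `q` at exactly one port, then `A` contains exactly one
port or misses exactly one, and at least two further edges leave `A` because the original graph has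
no small cuts. -/
theorem IsGoodPairing.two_le (hq : (Finset.univ.filter fun i => q i = 0).card = 2)
    (hempty : ∀ A : Set β, A.Nonempty → 3 ≤ cut H A + {i | o i ∈ A}.ncard)
    (hgood : IsGoodPairing H o q) (A : Set β) :
    2 ≤ cut H A + {i | ¬ (o i ∈ A ↔ q i = 0)}.ncard := by
  classical
  by_contra hcon
  rw [not_le] at hcon
  have hfin : ∀ q : Fin 4 → Fin 2, (Finset.univ.filter fun i => q i = 0).card = 2 →
      ∀ a : Fin 4 → Bool, (Finset.univ.filter fun i => ¬ (a i = true ↔ q i = 0)).card = 1 →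
      (Finset.univ.filter fun i => a i = true).card = 1 ∨
        (Finset.univ.filter fun i => ¬ a i = true).card = 1 := by decide +kernel
  have h1 := hfin q hq fun i => decide (o i ∈ A)
  simp only [decide_eq_true_eq, ← ncard_eq_card_filter] at h1
  rcases Nat.eq_zero_or_pos {i | ¬ (o i ∈ A ↔ q i = 0)}.ncard with h0 | h0
  · rw [Set.ncard_eq_zero] at h0
    have h2 := hgood A fun i => by
      by_contra hi
      have : i ∈ {i | ¬ (o i ∈ A ↔ q i = 0)} := hi
      rw [h0] at this
      exact this
    omega
  · rcases h1 (by omega) with h2 | h2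
    · obtain ⟨i, hi⟩ := (Set.ncard_pos (Set.toFinite _)).1 (h2 ▸ Nat.one_pos)
      have := hempty A ⟨o i, hi⟩
      omega
    · obtain ⟨i, hi⟩ := (Set.ncard_pos (Set.toFinite _)).1 (h2 ▸ Nat.one_pos)
      have := hempty Aᶜ ⟨o i, hi⟩
      rw [cut_compl] at this
      change 3 ≤ cut H A + {i | ¬ o i ∈ A}.ncard at this
      omega

/-- If a whole class of `q` ends at a vertex with `m` ports, then `3 - m` edges of `H` leave this
vertex, and it disagrees with the class at `m - 2` ports. The sum is 1, against
`IsGoodPairing.two_le`. -/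
theorem IsGoodPairing.injective (hq : (Finset.univ.filter fun i => q i = 0).card = 2)
    (hempty : ∀ A : Set β, A.Nonempty → 3 ≤ cut H A + {i | o i ∈ A}.ncard)
    (hdeg : ∀ u, gdeg H u + {i | o i = u}.ncard = 3) (hgood : IsGoodPairing H o q) (i j : Fin 4)
    (hij : o i = o j) (hqij : q i = q j) : i = j := by
  classical
  by_contra hne
  have hfin : ∀ q : Fin 4 → Fin 2, (Finset.univ.filter fun i => q i = 0).card = 2 →
      ∀ i j, i ≠ j → q i = q j → ∀ a : Fin 4 → Bool, a i = true → a j = true →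
      (Finset.univ.filter fun l => ¬ (a l = true ↔ q l = q i)).card + 2 =
        (Finset.univ.filter fun l => a l = true).card := by decide +kernel
  have h1 := hfin q hq i j hne hqij (fun l => decide (o l = o i)) (by simp) (by simp [hij])
  simp only [decide_eq_true_eq, ← ncard_eq_card_filter] at h1
  have h2 := hdeg (o i)
  have h01 : ∀ x : Fin 2, x = 0 ∨ x = 1 := by decide
  rcases h01 (q i) with h0 | h0
  · have h3 := hgood.two_le hq hempty {o i}
    rw [cut_singleton] at h3
    rw [h0] at h1
    simp only [Set.mem_singleton_iff] at h3
    omega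
  · have h3 := hgood.two_le hq hempty {o i}ᶜ
    rw [cut_compl, cut_singleton] at h3
    have h4 : {l | ¬ (o l ∈ ({o i} : Set β)ᶜ ↔ q l = 0)} = {l | ¬ (o l = o i ↔ q l = q i)} := by
      ext l
      rw [h0]
      rcases h01 (q l) with h5 | h5 <;> simp [h5]
    rw [h4] at h3
    omega

/-- A set that contains both ends of the new edge or neither gives a cut of the original graph.
Otherwise the new edge adds one to the bound of `IsGoodPairing.two_le`. -/
theorem IsGoodPairing.edgeThreeConnected [Finite β]
    (hq : (Finset.univ.filter fun i => q i = 0).card = 2)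
    (hempty : ∀ A : Set β, A.Nonempty → 3 ≤ cut H A + {i | o i ∈ A}.ncard)
    (huniv : ∀ A : Set β, Aᶜ.Nonempty → 3 ≤ cut H A + {i | o i ∉ A}.ncard)
    (hdeg : ∀ u, gdeg H u + {i | o i = u}.ncard = 3) (hgood : IsGoodPairing H o q) :
    EdgeThreeConnected (glue H (edgeFragment q).graph o (edgeFragment q).port fun _ => true) := by
  have h01 : ∀ x : Fin 2, x = 0 ∨ x = 1 := by decide
  suffices h : EdgeThreeConnected (glue H (listGraph 2 [(0, 1)]) o q fun _ => true) from h
  refine edgeThreeConnected_glue (hgood.injective hq hempty hdeg) fun A C h1 h2 => ?_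
  by_cases c0 : 0 ∈ C <;> by_cases c1 : 1 ∈ C
  · have : C = Set.univ := Set.eq_univ_of_forall fun x => by
      rcases h01 x with rfl | rfl <;> assumption
    subst this
    rw [glueCut_univ]
    refine huniv A (h2.resolve_right fun h => ?_)
    exact absurd h (by simp)
  · have h3 := hgood.two_le hq hempty A
    have h4 := one_le_cut_edge c0 c1
    have h5 : {i | ¬ (o i ∈ A ↔ q i ∈ C)} =
        {i | ¬ (o i ∈ A ↔ q i = 0)} := by
      ext i
      rcases h01 (q i) with h | h <;> simp [h, c0, c1]
    rw [glueCut, h5]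
    omega
  · have h3 := hgood.two_le hq hempty Aᶜ
    have h4 := one_le_cut_edge (C := Cᶜ) c0 (by simpa using c1)
    rw [cut_compl] at h3 h4
    have h5 : {i | ¬ (o i ∈ A ↔ q i ∈ C)} =
        {i | ¬ (o i ∈ Aᶜ ↔ q i = 0)} := by
      ext i
      rcases h01 (q i) with h | h <;> simp [h, c0, c1]
    rw [glueCut, h5]
    omega
  · have : C = ∅ := Set.eq_empty_of_forall_notMem fun x => by
      rcases h01 x with rfl | rfl <;> assumption
    subst this
    rw [glueCut_empty]
    refine hempty A (h1.resolve_right fun h => ?_)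
    exact absurd h (by simp)

/-- Let `A` and `B` be sets with at most one leaving edge that violate the two pairings. Only port
`0` lies in `A ∩ B` and only port `3` outside `A ∪ B`, so each of these sets has at least two
leaving edges in `H`, contrary to submodularity. -/
theorem firstPairing_or_secondPairing [Finite β]
    (hempty : ∀ A : Set β, A.Nonempty → 3 ≤ cut H A + {i | o i ∈ A}.ncard)
    (huniv : ∀ A : Set β, Aᶜ.Nonempty → 3 ≤ cut H A + {i | o i ∉ A}.ncard) :
    IsGoodPairing H o firstPairing ∨ IsGoodPairing H o secondPairing := by
  by_contra hcon
  simp only [IsGoodPairing, not_or, not_forall, not_le] at hcon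
  obtain ⟨⟨A, hA, hA'⟩, B, hB, hB'⟩ := hcon
  have h1 : {i | o i ∈ A ∩ B} = {0} := by
    ext i
    simp only [Set.mem_inter_iff, Set.mem_ofPred_eq, hA, hB, Set.mem_singleton_iff]
    revert i
    decide
  have h2 : {i | o i ∉ A ∪ B} = {3} := by
    ext i
    simp only [Set.mem_union, Set.mem_ofPred_eq, hA, hB, Set.mem_singleton_iff]
    revert i
    decide
  have h3 := hempty (A ∩ B) ⟨o 0, show (0 : Fin 4) ∈ {i | o i ∈ A ∩ B} from h1 ▸ rfl⟩
  have h4 := huniv (A ∪ B) ⟨o 3, show (3 : Fin 4) ∈ {i | o i ∉ A ∪ B} from h2 ▸ rfl⟩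
  rw [h1, Set.ncard_singleton] at h3
  rw [h2, Set.ncard_singleton] at h4
  have := cut_inter_add_cut_union_le H A B
  omega

theorem exists_crossing_edge {V : Type*} {F : SimpleGraph V} {u v : V} {A : Set V}
    (h : F.Reachable u v) (hu : u ∈ A) (hv : v ∉ A) :
    ∃ x y, x ∈ A ∧ y ∉ A ∧ F.Adj x y ∧ F.Reachable u x := by
  obtain ⟨w⟩ := h
  induction w with
  | nil => exact absurd hu hv
  | @cons a b c hab w ih =>
    by_cases hb : b ∈ A
    · obtain ⟨x, y, hx, hy, hxy, hr⟩ := ih hb hv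
      exact ⟨x, y, hx, hy, hxy, hab.reachable.trans hr⟩
    · exact ⟨a, b, hu, hb, hab, Reachable.refl _⟩

/-- If a single edge separates the classes of the second pairing, then outer components cannot join
exactly the classes of the first. -/
theorem joinsFirstPairing_eq_false [Finite β]
    (hbad : ¬ IsGoodPairing H o secondPairing)
    {F : SimpleGraph β} (hF : F ≤ H) {π : Fin 4 → Fin 4}
    (hπ : ∀ i j, π i = π j ↔ F.Reachable (o i) (o j)) : joinsFirstPairing π = false := by
  simp only [IsGoodPairing, not_forall, not_le] at hbad
  obtain ⟨A, hA, hcut⟩ := hbad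
  have h0 : o 0 ∈ A := (hA 0).2 rfl
  have h1 : o 1 ∉ A := fun h => absurd ((hA 1).1 h) (by decide)
  have h2 : o 2 ∈ A := (hA 2).2 rfl
  have h3 : o 3 ∉ A := fun h => absurd ((hA 3).1 h) (by decide)
  simp only [joinsFirstPairing, decide_eq_false_iff_not, not_and, ne_eq, hπ, not_not]
  intro h01 h23
  -- The paths from port `0` to `1` and from `2` to `3` both leave `A`, hence through the same edge,
  -- which puts them in one component.
  obtain ⟨x, y, hx, hy, hxy, hr⟩ := exists_crossing_edge h01 h0 h1
  obtain ⟨x', y', hx', hy', hxy', hr'⟩ := exists_crossing_edge h23 h2 h3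
  have hle : {e : β × β | e.1 ∈ A ∧ e.2 ∉ A ∧ H.Adj e.1 e.2}.ncard ≤ 1 := Nat.lt_succ_iff.1 hcut
  have := (Set.ncard_le_one (Set.toFinite _)).1 hle (x, y) ⟨hx, hy, hF hxy⟩ (x', y')
    ⟨hx', hy', hF hxy'⟩
  rw [Prod.mk.injEq] at this
  obtain ⟨rfl, rfl⟩ := this
  exact hr.trans hr'.symm

end Pairing

/-- The second pairing is tried first, as its table covers every outer partition. The first is used
only when the second is bad, which rules out the partition left out by `joinsFirstPairing`. -/
theorem Fragment.not_contained_of_four_ports {S : Fragment 4} {table₁ table₂ : List (ℕ × ℕ)}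
    {table : List ℕ} (hS : S.IsWellFormed) (hd : S.IsCubic) (hp : Function.Injective S.port)
    (hlt : 2 < S.n) (hclose : S.ClosesUp table)
    (hred₁ : S.IsReducibleTo (edgeFragment firstPairing) table₁ joinsFirstPairing)
    (hred₂ : S.IsReducibleTo (edgeFragment secondPairing) table₂ fun _ => false) {V : Type u}
    [Finite V] {G : SimpleGraph V} (hG : IsMinimalThreeConnectedCounterexample G)
    {f : Fin S.n → V} (hf : Function.Injective f)
    (hfG : ∀ a b, S.graph.Adj a b → G.Adj (f a) (f b)) : False := by
  have h3 := hG.1.2.1.edgeThreeConnected hG.1.1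
  rcases Fragment.exists_glue_iso_or_surjective le_rfl hS hd hp hG.1.1 h3 hf hfG with
    ⟨o, ⟨e⟩⟩ | ⟨hsurj, w, hw, hw', hG'⟩
  · have hcub := IsCubic.iso e.symm hG.1.1
    have hcut := (h3.iso e.symm).three_le_glueCut fun i j _ h => hp h
    have hdeg := Fragment.gdeg_add_ncard_eq_three hp hcub
    set H := G.comap (Subtype.val : {v // v ∉ Set.range f} → V)
    have hempty : ∀ A : Set {v // v ∉ Set.range f}, A.Nonempty →
        3 ≤ cut H A + {i | o i ∈ A}.ncard := by
      intro A hA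
      rw [← glueCut_empty S.graph S.port]
      exact hcut _ _ (Or.inl hA) (Or.inr ⟨⟨0, hS.pos⟩, by simp⟩)
    have huniv : ∀ A : Set {v // v ∉ Set.range f}, Aᶜ.Nonempty →
        3 ≤ cut H A + {i | o i ∉ A}.ncard := by
      intro A hA
      rw [← glueCut_univ S.graph S.port]
      exact hcut _ _ (Or.inr ⟨⟨0, hS.pos⟩, by simp⟩) (Or.inl hA)
    have hq₁ : (Finset.univ.filter fun i => firstPairing i = 0).card = 2 := by decide
    have hq₂ : (Finset.univ.filter fun i => secondPairing i = 0).card = 2 := by decide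
    by_cases hgood : IsGoodPairing H o secondPairing
    · exact Fragment.replace hS (edgeFragment_isWellFormed _)
        (show (edgeFragment ![0, 1, 0, 1]).IsCubic by decide) hred₂ hp hlt
        (exists_eq_listGraph_of_le_edgeFragment _) hG e (hgood.injective hq₂ hempty hdeg)
        (hgood.edgeThreeConnected hq₂ hempty huniv hdeg) fun _ _ _ _ => rfl
    · have hgood₁ := (firstPairing_or_secondPairing hempty huniv).resolve_right hgood
      exact Fragment.replace hS (edgeFragment_isWellFormed _)
        (show (edgeFragment ![0, 0, 1, 1]).IsCubic by decide) hred₁ hp hlt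
        (exists_eq_listGraph_of_le_edgeFragment _) hG e (hgood₁.injective hq₁ hempty hdeg)
        (hgood₁.edgeThreeConnected hq₁ hempty huniv hdeg)
        fun F hF π hπ => joinsFirstPairing_eq_false hgood hF hπ
  · have : Nontrivial V := by
      have := hG.1.2.1.1
      rw [← Finite.one_lt_card_iff_nontrivial]
      omega
    exact hG.1.2.2 ((Fragment.hasBalancedTree_of_closesUp hS hclose ⟨hf, hsurj⟩ hw hw'
      hG').hasThreeDecomposition hG.1.1)

/-! ### The six configurations -/

theorem isSubcubic_of_embedding {α : Type*} [Finite α] {S : SimpleGraph α} {n : ℕ}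
    {L : List (ℕ × ℕ)} (hL : IsSimpleList n L) (hd : ∀ a : Fin n, listDeg L a ≤ 3) (g : α → Fin n)
    (hg : Function.Injective g) (h : ∀ a b, S.Adj a b → (listGraph n L).Adj (g a) (g b)) :
    IsSubcubic S := by
  intro v
  rw [← Set.ncard_image_of_injective _ hg]
  refine (Set.ncard_le_ncard (t := (listGraph n L).neighborSet (g v)) ?_ (Set.toFinite _)).trans
    ((gdeg_listGraph hL (g v)).trans_le (hd _))
  rintro _ ⟨w, hw, rfl⟩
  exact h v w hw

theorem not_isContained_of_fragment {α : Type*} {S : SimpleGraph α} {k : ℕ} {R : Fragment k}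
    {V : Type u} [Finite V] {G : SimpleGraph V}
    (h : ∀ f : Fin R.n → V, Function.Injective f → (∀ a b, R.graph.Adj a b → G.Adj (f a) (f b)) →
      False) (g : Fin R.n → α) (hg : Function.Injective g)
    (hgS : ∀ a b, R.graph.Adj a b → S.Adj (g a) (g b)) : ¬ S.IsContained G := by
  rintro ⟨φ⟩
  exact h (φ ∘ g) (φ.injective.comp hg) fun a b hab => φ.toHom.map_adj (hgS a b hab)

theorem isReducible_triangle : IsReducibleConfiguration.{u} triangle := by
  -- In a pair, the binary digits of the first number select edges of the fragment, the lowest digit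
  -- the first edge of its list; those of the second select ports. The tables below are coded
  -- likewise.
  have hred : triangleFragment.IsReducibleTo vertexFragment
      [(3, 5), (5, 6), (6, 3), (3, 2), (3, 7), (5, 1), (6, 4)] fun _ => false :=
    ⟨by decide +kernel, by decide +kernel⟩
  refine ⟨isSubcubic_of_embedding (L := triangleFragment.edges) (by decide) (by decide) id
    Function.injective_id (by simp only [triangle, completeGraph, top_adj]; decide), ?_⟩
  intro V _ G hG
  exact not_isContained_of_fragment (fun f => Fragment.not_contained_of_three_ports
    ⟨by decide, by decide, by decide⟩ (by decide) (by decide) (by decide) hred hG) id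
    Function.injective_id fun a b hab => hab.ne

theorem isReducible_ktwothree : IsReducibleConfiguration.{u} ktwothree := by
  have hred : ktwothreeFragment.IsReducibleTo vertexFragment
      [(29, 6), (30, 5), (46, 3), (15, 1), (23, 2), (29, 7), (39, 4)] fun _ => false :=
    ⟨by decide +kernel, by decide +kernel⟩
  have hadj : ∀ a b : Fin 5, (listGraph 5 ktwothreeFragment.edges).Adj a b →
      ktwothree.Adj ((![.inl 0, .inl 1, .inr 0, .inr 1, .inr 2] : Fin 5 → Fin 2 ⊕ Fin 3) a)
        ((![.inl 0, .inl 1, .inr 0, .inr 1, .inr 2] : Fin 5 → Fin 2 ⊕ Fin 3) b) := by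
    simp only [ktwothree, completeBipartiteGraph_adj]
    decide +kernel
  have hinj : Function.Injective
      (![.inl 0, .inl 1, .inr 0, .inr 1, .inr 2] : Fin 5 → Fin 2 ⊕ Fin 3) := by decide +kernel
  refine ⟨isSubcubic_of_embedding (n := 5) (L := ktwothreeFragment.edges) (by decide +kernel)
    (by decide +kernel) (Sum.elim ![0, 1] ![2, 3, 4]) (by decide +kernel)
    (by simp only [ktwothree, completeBipartiteGraph_adj]; decide +kernel), ?_⟩
  intro V _ G hG
  exact not_isContained_of_fragment (fun f => Fragment.not_contained_of_three_ports
    ⟨by decide, by decide, by decide +kernel⟩ (by decide +kernel) (by decide) (by decide) hred hG)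
    _ hinj hadj

/-- The edges of the Petersen graph. -/
def petersenEdges : List (ℕ × ℕ) :=
  [(0, 1), (1, 2), (2, 3), (3, 4), (4, 0), (5, 7), (7, 9), (9, 6), (6, 8), (8, 5), (0, 5), (1, 6),
    (2, 7), (3, 8), (4, 9)]

theorem petersen_eq_listGraph : petersen = listGraph 10 petersenEdges := by
  ext a b
  simp only [petersen, fromEdgeSet_adj, Set.mem_insert_iff, Set.mem_singleton_iff]
  revert a b
  decide +kernel

theorem isReducible_petersenMinusVertex :
    IsReducibleConfiguration.{u} petersenMinusVertex := by
  have hred : petersenFragment.IsReducibleTo vertexFragment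
      [(923, 7), (2421, 7), (735, 4), (759, 7), (999, 1), (1526, 2)] fun _ => false :=
    ⟨by decide +kernel, by decide +kernel⟩
  have hadj : ∀ a b : Fin 9, (listGraph 9 petersenFragment.edges).Adj a b →
      (listGraph 10 petersenEdges).Adj a.succ b.succ := by decide +kernel
  refine ⟨isSubcubic_of_embedding (n := 10) (L := petersenEdges) (by decide +kernel)
    (by decide +kernel) Subtype.val Subtype.val_injective fun a b hab => ?_, ?_⟩
  · rw [← petersen_eq_listGraph]
    exact hab
  intro V _ G hG
  refine not_isContained_of_fragment (fun f => Fragment.not_contained_of_three_ports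
    ⟨by decide, by decide, by decide +kernel⟩ (by decide +kernel) (by decide) (by decide) hred hG)
    (fun a : Fin 9 => (⟨a.succ, Fin.succ_ne_zero a⟩ : {v : Fin 10 // v ≠ 0}))
    (fun a b hab => Fin.succ_injective _ (Subtype.mk.inj hab)) fun a b hab => ?_
  change petersen.Adj (Fin.succ a) (Fin.succ b)
  rw [petersen_eq_listGraph]
  exact hadj a b hab

theorem clawSquare_eq_graph : clawSquare = clawSquareFragment.graph := by
  change clawSquare = listGraph 8 clawSquareFragment.edges
  ext a b
  simp only [clawSquare, fromEdgeSet_adj, Set.mem_insert_iff, Set.mem_singleton_iff]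
  revert a b
  decide +kernel

theorem twinHouse_eq_graph : twinHouse = twinHouseFragment.graph := by
  change twinHouse = listGraph 6 twinHouseFragment.edges
  ext a b
  simp only [twinHouse, fromEdgeSet_adj, Set.mem_insert_iff, Set.mem_singleton_iff]
  revert a b
  decide +kernel

theorem domino_eq_graph : domino = dominoFragment.graph := by
  change domino = listGraph 6 dominoFragment.edges
  ext a b
  simp only [domino, fromEdgeSet_adj, Set.mem_insert_iff, Set.mem_singleton_iff]
  revert a b
  decide +kernel

theorem Fragment.isReducibleConfiguration {S : Fragment 4} {table₁ table₂ : List (ℕ × ℕ)}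
    {table : List ℕ} (hS : S.IsWellFormed) (hd : S.IsCubic) (hp : Function.Injective S.port)
    (hlt : 2 < S.n) (hdeg : ∀ a : Fin S.n, listDeg S.edges a ≤ 3) (hclose : S.ClosesUp table)
    (hred₁ : S.IsReducibleTo (edgeFragment firstPairing) table₁ joinsFirstPairing)
    (hred₂ : S.IsReducibleTo (edgeFragment secondPairing) table₂ fun _ => false) :
    IsReducibleConfiguration.{u} S.graph := by
  refine ⟨isSubcubic_of_embedding hS.simple hdeg id Function.injective_id fun _ _ h => h, ?_⟩
  intro V _ G hG
  exact not_isContained_of_fragment (fun f => Fragment.not_contained_of_four_ports hS hd hp hlt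
    hclose hred₁ hred₂ hG) id Function.injective_id fun _ _ h => h

theorem clawSquareFragment_isReducibleTo_firstPairing :
    clawSquareFragment.IsReducibleTo (edgeFragment firstPairing)
      [(231, 15), (590, 15), (157, 15), (253, 3), (375, 12), (571, 15), (125, 3), (343, 12),
        (944, 15), (126, 9), (235, 6), (247, 15), (371, 5), (411, 10)] joinsFirstPairing :=
  ⟨by decide +kernel, by decide +kernel⟩

theorem clawSquareFragment_isReducibleTo_secondPairing :
    clawSquareFragment.IsReducibleTo (edgeFragment secondPairing)
      [(157, 15), (231, 15), (571, 15), (590, 15), (758, 10), (935, 5), (371, 5), (411, 10),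
        (944, 15), (125, 3), (126, 9), (235, 6), (247, 15), (343, 12)] fun _ => false :=
  ⟨by decide +kernel, by decide +kernel⟩

theorem twinHouseFragment_isReducibleTo_firstPairing :
    twinHouseFragment.IsReducibleTo (edgeFragment firstPairing)
      [(54, 15), (7, 15), (78, 15), (31, 3), (62, 12), (30, 3), (54, 12), (61, 9), (93, 5),
        (107, 10), (115, 6), (51, 5), (53, 10), (55, 15), (58, 6), (75, 9)] joinsFirstPairing :=
  ⟨by decide +kernel, by decide +kernel⟩

theorem twinHouseFragment_isReducibleTo_secondPairing :
    twinHouseFragment.IsReducibleTo (edgeFragment secondPairing)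
      [(78, 15), (7, 15), (54, 15), (59, 5), (117, 10), (51, 5), (53, 10), (55, 12), (61, 9),
        (115, 6), (30, 3), (54, 12), (55, 15), (58, 6), (75, 9)] fun _ => false :=
  ⟨by decide +kernel, by decide +kernel⟩

theorem dominoFragment_isReducibleTo_firstPairing :
    dominoFragment.IsReducibleTo (edgeFragment firstPairing)
      [(57, 15), (7, 15), (54, 15), (55, 3), (62, 12), (112, 15), (54, 3), (54, 12), (27, 9),
        (45, 6), (55, 15), (75, 5), (77, 10)] joinsFirstPairing :=
  ⟨by decide +kernel, by decide +kernel⟩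

theorem dominoFragment_isReducibleTo_secondPairing :
    dominoFragment.IsReducibleTo (edgeFragment secondPairing)
      [(54, 15), (7, 15), (57, 15), (91, 5), (109, 10), (112, 15), (75, 5), (77, 10), (27, 9),
        (45, 6), (54, 3), (54, 12), (55, 15), (93, 9), (107, 6)] fun _ => false :=
  ⟨by decide +kernel, by decide +kernel⟩

theorem isReducible_clawSquare : IsReducibleConfiguration.{u} clawSquare := by
  have hclose : clawSquareFragment.ClosesUp [253, 758, 506] := by decide +kernel
  rw [clawSquare_eq_graph]
  exact Fragment.isReducibleConfiguration ⟨by decide, by decide, by decide +kernel⟩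
    (by decide +kernel) (by decide) (by decide) (by decide +kernel) hclose
    clawSquareFragment_isReducibleTo_firstPairing clawSquareFragment_isReducibleTo_secondPairing

theorem isReducible_twinHouse : IsReducibleConfiguration.{u} twinHouse := by
  have hclose : twinHouseFragment.ClosesUp [59, 91] := by decide +kernel
  rw [twinHouse_eq_graph]
  exact Fragment.isReducibleConfiguration ⟨by decide, by decide, by decide +kernel⟩
    (by decide +kernel) (by decide) (by decide) (by decide +kernel) hclose
    twinHouseFragment_isReducibleTo_firstPairing twinHouseFragment_isReducibleTo_secondPairing

theorem isReducible_domino : IsReducibleConfiguration.{u} domino := by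
  -- The tree consists of the middle edge and the four edges from it to the ports. All ports are
  -- leaves, so any matching of them is balanced.
  have hclose : dominoFragment.ClosesUp [62] := by decide +kernel
  rw [domino_eq_graph]
  exact Fragment.isReducibleConfiguration ⟨by decide, by decide, by decide +kernel⟩
    (by decide +kernel) (by decide) (by decide) (by decide +kernel) hclose
    dominoFragment_isReducibleTo_firstPairing dominoFragment_isReducibleTo_secondPairing

end ThreeDec

theorem mainTheorem3 :
    ThreeDec.IsReducibleConfiguration.{u} ThreeDec.triangle ∧
    ThreeDec.IsReducibleConfiguration.{u} ThreeDec.ktwothree ∧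
    ThreeDec.IsReducibleConfiguration.{u} ThreeDec.petersenMinusVertex ∧
    ThreeDec.IsReducibleConfiguration.{u} ThreeDec.clawSquare ∧
    ThreeDec.IsReducibleConfiguration.{u} ThreeDec.twinHouse ∧
    ThreeDec.IsReducibleConfiguration.{u} ThreeDec.domino :=
  ⟨ThreeDec.isReducible_triangle, ThreeDec.isReducible_ktwothree,
    ThreeDec.isReducible_petersenMinusVertex, ThreeDec.isReducible_clawSquare,
    ThreeDec.isReducible_twinHouse, ThreeDec.isReducible_domino⟩
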